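/- Let $d\ge 2$. **Classical Besov norm.** Let $\varphi,\Phi\in\mathcal S(\mathbb R^d)$ with $\operatorname{supp}\hat\varphi\subseteq\{\frac12\le|\xi|\le2\}$, $\operatorname{supp}\hat\Phi\subseteq\{|\xi|\le2\}$, $|\hat\varphi|\ge c>0$ on $\{\frac35\le|\xi|\le\frac53\}$ and $|\hat\Phi|\ge c>0$ on $\{|\xi|\le\frac53\}$. For $f\in\mathcal S'(\mathbb{R}^d)$ put $$\|f\|_{\mathbf B^{\alpha,q}_p}=\|\Phi*f\|_{L^p}+\Big(\sum_{\nu\ge0}\big(2^{\nu\alpha}\|2^{d\nu}\varphi(2^\nu\cdot)*f\|_{L^p}\big)^q\Big)^{1/q}.$$ **Shearlets.** Let $\hat\psi_1,\hat\psi_2\in C^\infty(\mathbb R)$ (complex valued) with $\operatorname{supp}\hat\psi_1\subseteq[-\frac12,-\frac1{16}]\cup[\frac1{16},\frac12]$, $\operatorname{supp}\hat\psi_2\subseteq[-1,1]$, $\sum_{j\ge0}|\hat\psi_1(2^{-2j}\omega)|^2=1$ for $|\omega|\ge\frac18$ and $|\hat\psi_2(\omega-1)|^2+|\hat\psi_2(\omega)|^2+|\hat\psi_2(\omega+1)|^2=1$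 for $|\omega|\le1$. Let $\Psi\in\mathcal S(\mathbb R^d)$ with $\operatorname{supp}\hat\Psi\subseteq[-\frac14,\frac14]^d$ and $|\hat\Psi|=1$ on $[-\frac18,\frac18]^d$. For $i=1,\dots,d$ let $\hat\psi^{(i)}(\xi)=\hat\psi_1(\xi_i)\prod_{k\ne i}\hat\psi_2(\xi_k/\xi_i)$, let $A_{(i)}$ be the diagonal matrix with entry $4$ at place $i$ and $2$ elsewhere, and, for $\ell=(\ell_k)_{k\neq i}\in\mathbb Z^{d-1}$, let $B^{[\ell]}_{(i)}$ be the identity matrix with the off-diagonal entries of row $i$ replaced by the $\ell_k$. Write $\psi^{(i)}_{j,\ell,k}(x)=|\det A_{(i)}|^{j/2}\,\psi^{(i)}(B^{[\ell]}_{(i)}A^j_{(i)}x-k)$, $\psi^{(i)}_{A^{-j}B^{-\ell}}(x)=|\det A_{(i)}|^{j}\,\psi^{(i)}(B_{(i)}^{[\ell]}A_{(i)}^jx)$ and $|Q_j|=2^{-(d+1)j}$. For $f\in\mathcal S'(\mathbb R^d)$ put $$\|f\|_{\mathbf B^{\alpha,q}_p(AB)}=\|f*\Psi\|_{L^p}+\Big(\sum_{i=1}^d\sum_{j\ge0}\sum_{|\ell_k|\le2^j\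 (k\ne i)}\big(|Q_j|^{-\alpha}\|f*\psi^{(i)}_{A^{-j}B^{-\ell}}\|_{L^p}\big)^q\Big)^{1/q}.$$ In both norms the $\ell^q$ norm is the supremum if $q=\infty$. Let $\mathbf B^{\alpha,q}_p(AB)$ be the set of $f\in\mathcal S'(\mathbb{R}^d)$ with $\|f\|_{\mathbf B^{\alpha,q}_p(AB)}<\infty$. **Theorem.** Let $\alpha_1,\alpha_2\in\mathbb R$ and $0<p_1,p_2,q_1,q_2\le\infty$ be such that (with $\frac1\infty=0$) $$2\alpha_1+\tfrac32d<(d+1)\Big(\alpha_2-\frac d{p_2(d+1)}+\frac12\Big)+\frac12+\frac d{p_1}.$$ Then, for every $i\in\{1,\dots,d\}$, there are Schwartz functions $f^{(j)}\in\mathbf B^{\alpha_2,q_2}_{p_2}(AB)$, $j\ge0$, and constants $0<c\le C<\infty$ such that $$c\le\|f^{(j)}\|_{\mathbf B^{\alpha_2,q_2}_{p_2}(AB)}\le C\quad\text{for all }j\ge0,\qquad\text{but}\qquad\lim_{j\to\infty}\|f^{(j)}\|_{\mathbf B^{\alpha_1,q_1}_{p_1}}=0.$$ If moreover $\frac1{p_2}\le\frac1{p_1}+d-1$,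 then each $f^{(j)}$ can be taken to be a multiple of the single shearlet $\psi^{(i)}_{j,0,0}$. -/

import Mathlib

open MeasureTheory SchwartzMap Filter Topology
open scoped ENNReal FourierTransform ContDiff Matrix

namespace Shearlet

noncomputable section

/-! ### Matrices and dilations -/

/-- The space `ℝ^d` with its Euclidean norm. -/
abbrev Space (d : ℕ) := EuclideanSpace ℝ (Fin d)

/-- An invertible diagonal matrix. -/
def diagGL {d : ℕ} (v : Fin d → ℝ) (hv : ∀ k, v k ≠ 0) : GL (Fin d) ℝ :=
  Matrix.GeneralLinearGroup.mkOfDetNeZero (Matrix.diagonal v)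
    (by rw [Matrix.det_diagonal]; exact Finset.prod_ne_zero_iff.mpr fun k _ => hv k)

/-- The anisotropic dilation matrix `A_{(i)}`: diagonal, with entry `4` at place `i` and entries `2`
elsewhere. -/
def anisoA {d : ℕ} (i : Fin d) : GL (Fin d) ℝ :=
  diagGL (fun k => if k = i then 4 else 2) (by intro k; split_ifs <;> norm_num)

/-- The isotropic dilation matrix `2 I`. -/
def dyadicI (d : ℕ) : GL (Fin d) ℝ :=
  diagGL (fun _ => 2) (by intro k; norm_num)

/-- The entries of the shear matrix `B_{(i)}^{[ℓ]}`: ones on the diagonal, the entries `ℓ k` (`k ≠ i`)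
in row `i`, zeros elsewhere. -/
def shearMatrix {d : ℕ} (i : Fin d) (ℓ : Fin d → ℤ) : Matrix (Fin d) (Fin d) ℝ :=
  Matrix.of fun a b => if a = b then 1 else if a = i then (ℓ b : ℝ) else 0

theorem shearMatrix_mul_neg {d : ℕ} (i : Fin d) (ℓ : Fin d → ℤ) :
    shearMatrix i ℓ * shearMatrix i (-ℓ) = 1 := by
  have h : ∀ m : Fin d → ℤ, shearMatrix i m =
      1 + Matrix.vecMulVec (Pi.single i (1 : ℝ)) (fun b => if b = i then 0 else (m b : ℝ)) := by
    intro m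
    ext a b
    by_cases hab : a = b <;> by_cases ha : a = i <;> by_cases hb : b = i <;>
      simp_all [shearMatrix, Matrix.vecMulVec_apply, Matrix.one_apply, Pi.single_apply]
  have h0 : (fun b => if b = i then (0 : ℝ) else ((-ℓ) b : ℝ)) =
      -(fun b => if b = i then (0 : ℝ) else (ℓ b : ℝ)) := by
    ext b
    by_cases hb : b = i <;> simp [hb]
  rw [h, h, h0]
  simp [add_mul, mul_add, Matrix.vecMulVec_mul_vecMulVec, Matrix.vecMulVec_neg]

/-- The shear matrix `B_{(i)}^{[ℓ]}` as an invertible matrix. -/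
def shearB {d : ℕ} (i : Fin d) (ℓ : Fin d → ℤ) : GL (Fin d) ℝ where
  val := shearMatrix i ℓ
  inv := shearMatrix i (-ℓ)
  val_inv := shearMatrix_mul_neg i ℓ
  inv_val := by simpa using shearMatrix_mul_neg i (-ℓ)

/-- The action `x ↦ N x` of an invertible matrix on `ℝ^d`. -/
def matAct {d : ℕ} (N : GL (Fin d) ℝ) : Space d ≃L[ℝ] Space d :=
  ContinuousLinearEquiv.unitsEquiv ℝ (Space d)
    (Units.map (Matrix.toEuclideanCLM (n := Fin d) (𝕜 := ℝ)).toMonoidHom N)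

/-- The composition `x ↦ g (N x)`. -/
def compMat {d : ℕ} (N : GL (Fin d) ℝ) (g : 𝓢(Space d, ℂ)) : 𝓢(Space d, ℂ) :=
  compCLMOfContinuousLinearEquiv ℂ (matAct N) g

/-- The `L¹`-normalised dilation `x ↦ |det N| g (N x)`. In the notation
`g_M (x) = |det M|⁻¹ g (M⁻¹ x)` this is `g_M` with `M = N⁻¹`. -/
def dilate {d : ℕ} (N : GL (Fin d) ℝ) (g : 𝓢(Space d, ℂ)) : 𝓢(Space d, ℂ) :=
  |(N : Matrix (Fin d) (Fin d) ℝ).det| • compMat N g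

/-- The convolution `(f ∗ g)(x) = ⟨f, g (x - ·)⟩` of a tempered distribution with a Schwartz
function (the pairing is bilinear). -/
def conv {d : ℕ} (f : 𝓢'(Space d, ℂ)) (g : 𝓢(Space d, ℂ)) (x : Space d) : ℂ :=
  f (compCLMOfContinuousLinearEquiv ℂ (ContinuousLinearEquiv.neg ℝ) (compSubConstCLM ℂ (-x) g))

/-- The `ℓ^q` (quasi-)norm of a family of extended nonnegative numbers, `0 < q ≤ ∞`. -/
def lqNorm {ι : Type} (q : ℝ≥0∞) (a : ι → ℝ≥0∞) : ℝ≥0∞ :=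
  if q = ⊤ then ⨆ n, a n else (∑' n, a n ^ q.toReal) ^ (1 / q.toReal)

/-! ### Classical inhomogeneous Besov spaces -/

/-- The conditions on the pair `(Φ, φ)` generating the classical inhomogeneous Besov norms. -/
structure IsDyadicPair {d : ℕ} (Φ φ : 𝓢(Space d, ℂ)) : Prop where
  supp_φ : tsupport (𝓕 φ : 𝓢(Space d, ℂ)) ⊆ {ξ | 1 / 2 ≤ ‖ξ‖ ∧ ‖ξ‖ ≤ 2}
  supp_Φ : tsupport (𝓕 Φ : 𝓢(Space d, ℂ)) ⊆ {ξ | ‖ξ‖ ≤ 2}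
  pos_φ : ∃ c > 0, ∀ ξ : Space d, 3 / 5 ≤ ‖ξ‖ → ‖ξ‖ ≤ 5 / 3 → c ≤ ‖(𝓕 φ : 𝓢(Space d, ℂ)) ξ‖
  pos_Φ : ∃ c > 0, ∀ ξ : Space d, ‖ξ‖ ≤ 5 / 3 → c ≤ ‖(𝓕 Φ : 𝓢(Space d, ℂ)) ξ‖

/-- The classical inhomogeneous Besov (quasi-)norm
`‖Φ ∗ f‖_p + (∑_{ν ≥ 0} (2^{να} ‖φ_{2^ν I} ∗ f‖_p)^q)^{1/q}`,
where `φ_{2^ν I}(x) = 2^{dν} φ(2^ν x)`. -/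
def besovNorm {d : ℕ} (Φ φ : 𝓢(Space d, ℂ)) (α : ℝ) (p q : ℝ≥0∞) (f : 𝓢'(Space d, ℂ)) : ℝ≥0∞ :=
  eLpNorm (conv f Φ) p volume +
    lqNorm q fun ν : ℕ =>
      ENNReal.ofReal (2 ^ ((ν : ℝ) * α)) * eLpNorm (conv f (dilate (dyadicI d ^ ν) φ)) p volume

/-! ### Shearlets on the cones -/

/-- The generators of a cone-adapted shearlet system: the univariate functions `ψ̂₁`, `ψ̂₂` and the
low frequency function `Ψ`. Up to the null set where the cones
`{|ξ_i| ≥ 1/8, |ξ_k / ξ_i| ≤ 1 for k ≠ i}` and the cube `[-1/8, 1/8]^d` meet each other, these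
conditions imply the Parseval frame condition
`|Ψ̂|² χ_{[-1/8,1/8]^d} + ∑_i ∑_j ∑_ℓ |ψ̂^{(i)}(ξ A_{(i)}^{-j} B_{(i)}^{[-ℓ]})|² χ_{D^{(i)}} = 1`. -/
structure Generators (d : ℕ) where
  ψhat1 : ℝ → ℂ
  ψhat2 : ℝ → ℂ
  Ψ : 𝓢(Space d, ℂ)
  smooth1 : ContDiff ℝ ∞ ψhat1
  smooth2 : ContDiff ℝ ∞ ψhat2
  supp1 : tsupport ψhat1 ⊆ Set.Icc (-1 / 2) (-1 / 16) ∪ Set.Icc (1 / 16) (1 / 2)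
  supp2 : tsupport ψhat2 ⊆ Set.Icc (-1) 1
  sum1 : ∀ t : ℝ, 1 / 8 ≤ |t| →
    HasSum (fun j : ℕ => ‖ψhat1 (((2 : ℝ) ^ (2 * j))⁻¹ * t)‖ ^ 2) 1
  sum2 : ∀ t : ℝ, |t| ≤ 1 →
    ‖ψhat2 (t - 1)‖ ^ 2 + ‖ψhat2 t‖ ^ 2 + ‖ψhat2 (t + 1)‖ ^ 2 = 1
  supp_Ψ : tsupport (𝓕 Ψ : 𝓢(Space d, ℂ)) ⊆ {ξ | ∀ k, |ξ k| ≤ 1 / 4}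
  abs_Ψ : ∀ ξ : Space d, (∀ k, |ξ k| ≤ 1 / 8) → ‖(𝓕 Ψ : 𝓢(Space d, ℂ)) ξ‖ = 1

namespace Generators

variable {d : ℕ} (S : Generators d)

/-- `ψ̂^{(i)}(ξ) = ψ̂₁(ξ_i) ∏_{k ≠ i} ψ̂₂(ξ_k / ξ_i)`. (It vanishes for `|ξ_i| < 1/16`, so the value
of the quotient at `ξ_i = 0` is irrelevant.) -/
def ψhat (i : Fin d) (ξ : Space d) : ℂ :=
  S.ψhat1 (ξ i) * ∏ k ∈ Finset.univ.erase i, S.ψhat2 (ξ k / ξ i)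

theorem ψhat1_eq_zero {t : ℝ} (h : |t| < 1 / 16 ∨ 1 / 2 < |t|) : S.ψhat1 t = 0 := by
  by_contra hne
  have ht := S.supp1 (subset_tsupport _ hne)
  simp only [Set.mem_union, Set.mem_Icc] at ht
  rcases ht with ht | ht
  · rw [abs_of_neg (by linarith)] at h
    rcases h with h | h <;> linarith
  · rw [abs_of_pos (by linarith)] at h
    rcases h with h | h <;> linarith

theorem ψhat2_eq_zero {t : ℝ} (h : 1 < |t|) : S.ψhat2 t = 0 := by
  by_contra hne
  have ht := S.supp2 (subset_tsupport _ hne)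
  exact absurd (abs_le.mpr ht) (not_le.mpr h)

theorem contDiff_ψhat (i : Fin d) : ContDiff ℝ ∞ (S.ψhat i) := by
  rw [contDiff_iff_contDiffAt]
  intro ξ
  have hc : ∀ k : Fin d, ContDiff ℝ ∞ (fun ζ : Space d => ζ k) := fun k =>
    (EuclideanSpace.proj (𝕜 := ℝ) k).contDiff
  by_cases h : ξ i = 0
  · have hev : S.ψhat i =ᶠ[𝓝 ξ] fun _ => 0 := by
      have hopen : IsOpen {ζ : Space d | |ζ i| < 1 / 16} :=
        isOpen_lt ((hc i).continuous.abs) continuous_const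
      filter_upwards [hopen.mem_nhds (show |ξ i| < 1 / 16 by rw [h]; norm_num)] with ζ hζ
      simp [ψhat, S.ψhat1_eq_zero (Or.inl hζ)]
    exact contDiffAt_const.congr_of_eventuallyEq hev
  · refine ContDiffAt.mul (S.smooth1.comp (hc i)).contDiffAt ?_
    refine contDiffAt_prod fun k _ => ?_
    exact S.smooth2.contDiffAt.comp ξ ((hc k).contDiffAt.div (hc i).contDiffAt h)

theorem hasCompactSupport_ψhat (i : Fin d) : HasCompactSupport (S.ψhat i) := by
  refine HasCompactSupport.intro
    (K := (WithLp.toLp 2 : (Fin d → ℝ) → Space d) '' Set.univ.pi fun _ => Set.Icc (-1 / 2) (1 / 2))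
    ((isCompact_univ_pi fun _ => isCompact_Icc).image (PiLp.continuous_toLp 2 _)) ?_
  intro ξ hξ
  by_contra hne
  apply hξ
  refine ⟨WithLp.ofLp ξ, ?_, rfl⟩
  intro k _
  have h1 : S.ψhat1 (ξ i) ≠ 0 := left_ne_zero_of_mul hne
  have hi : |ξ i| ≤ 1 / 2 := by
    by_contra hlt
    exact h1 (S.ψhat1_eq_zero (Or.inr (not_le.mp hlt)))
  have hi' : 1 / 16 ≤ |ξ i| := by
    by_contra hlt
    exact h1 (S.ψhat1_eq_zero (Or.inl (not_le.mp hlt)))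
  have hk : |ξ k| ≤ 1 / 2 := by
    by_cases hki : k = i
    · rw [hki]; exact hi
    · have h2 := Finset.prod_ne_zero_iff.mp (right_ne_zero_of_mul hne) k
        (Finset.mem_erase.mpr ⟨hki, Finset.mem_univ k⟩)
      have h3 : |ξ k / ξ i| ≤ 1 := by
        by_contra hlt
        exact h2 (S.ψhat2_eq_zero (not_le.mp hlt))
      rw [abs_div, div_le_one (by linarith)] at h3
      linarith
  have := abs_le.mp hk
  exact ⟨by linarith [this.1], this.2⟩

/-- The generating shearlet `ψ^{(i)}` of the cone in direction `i`, defined by its Fourier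
transform `ψ̂^{(i)}`. -/
def ψ (i : Fin d) : 𝓢(Space d, ℂ) :=
  𝓕⁻ ((S.hasCompactSupport_ψhat i).toSchwartzMap (S.contDiff_ψhat i))

/-- The shearlet `ψ^{(i)}_{j,ℓ,k}(x) = |det A_{(i)}|^{j/2} ψ^{(i)}(B_{(i)}^{[ℓ]} A_{(i)}^j x - k)`. -/
def shearlet (i : Fin d) (j : ℕ) (ℓ : Fin d → ℤ) (k : Fin d → ℤ) : 𝓢(Space d, ℂ) :=
  (|(anisoA i : Matrix (Fin d) (Fin d) ℝ).det| ^ ((j : ℝ) / 2)) •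
    compMat (shearB i ℓ * anisoA i ^ j)
      (compSubConstCLM ℂ (WithLp.toLp 2 fun n => (k n : ℝ)) (S.ψ i))

end Generators

/-- The triples (direction `i`, scale `j ≥ 0`, shear `ℓ` with `|ℓ_k| ≤ 2^j`). A shear index in
`ℤ^{d-1}`, indexed by `k ≠ i`, is encoded as a vector in `ℤ^d` whose `i`-th entry is zero. -/
abbrev ShearIndex (d : ℕ) : Type :=
  (i : Fin d) × (j : ℕ) × {ℓ : Fin d → ℤ // ℓ i = 0 ∧ ∀ k, |ℓ k| ≤ 2 ^ j}

/-- The volume `|Q_j| = 2^{-(d+1)j}` of the parallelepipeds of scale `j`. -/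
def volQ (d j : ℕ) : ℝ := 2 ^ (-(((d : ℝ) + 1) * j))

/-- The shear anisotropic inhomogeneous Besov (quasi-)norm
`‖f ∗ Ψ‖_p + (∑_i ∑_{j ≥ 0} ∑_{|[ℓ]| ≼ 2^j} (|Q_j|^{-α} ‖f ∗ ψ^{(i)}_{A^{-j} B^{-ℓ}}‖_p)^q)^{1/q}`. -/
def besovABNorm {d : ℕ} (S : Generators d) (α : ℝ) (p q : ℝ≥0∞) (f : 𝓢'(Space d, ℂ)) : ℝ≥0∞ :=
  eLpNorm (conv f S.Ψ) p volume +
    lqNorm q fun n : ShearIndex d =>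
      ENNReal.ofReal (volQ d n.2.1 ^ (-α)) *
        eLpNorm (conv f (dilate (shearB n.1 n.2.2.1 * anisoA n.1 ^ n.2.1) (S.ψ n.1))) p volume

/-- The shear anisotropic inhomogeneous Besov space. -/
def besovAB {d : ℕ} (S : Generators d) (α : ℝ) (p q : ℝ≥0∞) : Set 𝓢'(Space d, ℂ) :=
  {f | besovABNorm S α p q f < ⊤}

end

end Shearlet

namespace Shearlet

/-! ### Linear changes of variables -/

section ChangeOfVariables

variable {d : ℕ}

/-! Only the growth rates in `j` of the two norms along an explicit family matter. If the classical
norm is at most a constant times `2^{γj}` for large `j`, the shearlet norm at least a constant times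
`2^{βj}`, and `γ < β`, then dividing by the shearlet norm (positive and finite) gives the
counterexample; this is `exists_normalization`. No quantitative upper bound on the shearlet norm is
needed, because band-limited functions meet only finitely many shearlet scales.

Two families suffice. The dilates `ψ^{(i)}(A^j x)` have frequencies of size about `4^j`, so a
bounded number of dyadic blocks near `ν = 2j` see them, and `γ = 2α₁ - (d+1)/p₁`. The matching
shearlet coefficient alone gives `β = (d+1)(α₂ - 1/p₂)`. The hypothesis reads `2α₁ < (d+1)α₂ - d/p₂
+ d/p₁ + 1 - d`, which implies `γ < β` as soon as `1/p₂ ≤ 1/p₁ + d - 1`.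

In the remaining case `1/p₂ > 1/p₁`. The wide bumps `Ψ(2^{-j} x)` then have frequencies near the
origin, only the low frequency term of the classical norm survives, and the rates are `γ = d/p₁` and
`β = d/p₂`.

The analytic core is `eLpNorm_conv_compMat_dilate`: a convolution of dilates by `M` and `N` has norm
`|det M|^{-1/p}` times that of `linConv f g T` with `T = M N⁻¹`. The last factor is bounded
uniformly for `T` in a bounded set (`exists_eLpNorm_linConv_le`), and it is bounded below for large
`j` as `T = 2^{-j} I → 0` (`exists_le_eLpNorm_linConv_contraction`). -/

theorem matAct_apply (N : GL (Fin d) ℝ) (x : Space d) :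
    matAct N x = WithLp.toLp 2 ((N : Matrix (Fin d) (Fin d) ℝ) *ᵥ WithLp.ofLp x) := rfl

theorem matAct_mul (M N : GL (Fin d) ℝ) (x : Space d) :
    matAct (M * N) x = matAct M (matAct N x) := by
  simp [matAct_apply, Matrix.mulVec_mulVec]

theorem matAct_one (x : Space d) : matAct (1 : GL (Fin d) ℝ) x = x := by
  simp [matAct_apply]

theorem matAct_inv_matAct (N : GL (Fin d) ℝ) (x : Space d) : matAct N⁻¹ (matAct N x) = x := by
  rw [← matAct_mul, inv_mul_cancel, matAct_one]

theorem matAct_matAct_inv (N : GL (Fin d) ℝ) (x : Space d) : matAct N (matAct N⁻¹ x) = x := by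
  rw [← matAct_mul, mul_inv_cancel, matAct_one]

theorem det_ne_zero (N : GL (Fin d) ℝ) : (N : Matrix (Fin d) (Fin d) ℝ).det ≠ 0 :=
  (Matrix.isUnit_iff_isUnit_det _ |>.mp N.isUnit).ne_zero

theorem map_matAct_volume (N : GL (Fin d) ℝ) :
    Measure.map (matAct N) (volume : Measure (Space d)) =
      ENNReal.ofReal |(N : Matrix (Fin d) (Fin d) ℝ).det|⁻¹ • volume := by
  have hdet : LinearMap.det (Matrix.toEuclideanLin (N : Matrix (Fin d) (Fin d) ℝ)) =
      (N : Matrix (Fin d) (Fin d) ℝ).det := LinearMap.det_toLpLin 2 _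
  have h := Measure.map_linearMap_addHaar_eq_smul_addHaar (volume : Measure (Space d))
    (f := Matrix.toEuclideanLin (N : Matrix (Fin d) (Fin d) ℝ)) (by rw [hdet]; exact det_ne_zero N)
  rw [hdet, abs_inv] at h
  exact h

theorem integral_comp_matAct (N : GL (Fin d) ℝ) (g : Space d → ℂ) :
    ∫ x, g (matAct N x) = |(N : Matrix (Fin d) (Fin d) ℝ).det|⁻¹ • ∫ x, g x := by
  have h := (matAct N).toHomeomorph.toMeasurableEquiv.measurableEmbedding.integral_map
    (μ := (volume : Measure (Space d))) g
  change ∫ y, g y ∂(Measure.map (matAct N) volume) = ∫ x, g (matAct N x) at h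
  rw [← h, map_matAct_volume, integral_smul_measure, ENNReal.toReal_ofReal (by positivity)]

/-- Writing `1/p` as `(p⁻¹).toReal` gives exponent `0` at `p = ∞`, so that case needs no separate
treatment. -/
theorem eLpNorm_comp_matAct (N : GL (Fin d) ℝ) {g : Space d → ℂ} (hg : Continuous g) (p : ℝ≥0∞) :
    eLpNorm (fun x => g (matAct N x)) p volume =
      ENNReal.ofReal (|(N : Matrix (Fin d) (Fin d) ℝ).det| ^ (-(p⁻¹).toReal)) *
        eLpNorm g p volume := by
  have hpos : 0 < |(N : Matrix (Fin d) (Fin d) ℝ).det|⁻¹ :=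
    inv_pos.mpr (abs_pos.mpr (det_ne_zero N))
  have h := eLpNorm_map_measure (p := p) (μ := (volume : Measure (Space d)))
    hg.aestronglyMeasurable (matAct N).continuous.aemeasurable
  rw [map_matAct_volume, eLpNorm_smul_measure_of_ne_zero (by simpa using hpos.not_ge)] at h
  change _ = eLpNorm (fun x => g (matAct N x)) p volume at h
  rw [← h, smul_eq_mul, ENNReal.ofReal_rpow_of_pos hpos, one_div, Real.inv_rpow (abs_nonneg _),
    Real.rpow_neg (abs_nonneg _)]

theorem inner_matAct (N : GL (Fin d) ℝ) (x y : Space d) :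
    inner ℝ (matAct N x) y =
      inner ℝ x (WithLp.toLp 2 ((N : Matrix (Fin d) (Fin d) ℝ)ᵀ *ᵥ WithLp.ofLp y)) := by
  simp only [matAct_apply, EuclideanSpace.inner_eq_star_dotProduct, star_trivial]
  rw [Matrix.dotProduct_mulVec, Matrix.mulVec_transpose]

/-- The Fourier transform of a dilate, evaluated at `Nᵀ η`. -/
theorem fourier_dilate_transpose (N : GL (Fin d) ℝ) (g : 𝓢(Space d, ℂ)) (η : Space d) :
    (𝓕 (dilate N g) : 𝓢(Space d, ℂ))
      (WithLp.toLp 2 ((N : Matrix (Fin d) (Fin d) ℝ)ᵀ *ᵥ WithLp.ofLp η)) =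
      (𝓕 g : 𝓢(Space d, ℂ)) η := by
  have hdet : |(N : Matrix (Fin d) (Fin d) ℝ).det| ≠ 0 := abs_ne_zero.mpr (det_ne_zero N)
  rw [fourier_coe, fourier_coe, Real.fourier_eq, Real.fourier_eq]
  simp_rw [← inner_matAct]
  rw [← smul_inv_smul₀ hdet (∫ v : Space d, Real.fourierChar (-inner ℝ v η) • g v),
    ← integral_comp_matAct N (fun v => Real.fourierChar (-inner ℝ v η) • g v), ← integral_smul]
  refine integral_congr_ae (ae_of_all _ fun x => ?_)
  change Real.fourierChar _ • (|(N : Matrix (Fin d) (Fin d) ℝ).det| • g (matAct N x)) = _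
  exact smul_comm _ _ _

theorem exists_transpose_mulVec (N : GL (Fin d) ℝ) (ξ : Space d) :
    ∃ η : Space d, ξ = WithLp.toLp 2 ((N : Matrix (Fin d) (Fin d) ℝ)ᵀ *ᵥ WithLp.ofLp η) := by
  refine ⟨WithLp.toLp 2 (((N⁻¹ : GL (Fin d) ℝ) : Matrix (Fin d) (Fin d) ℝ)ᵀ *ᵥ WithLp.ofLp ξ), ?_⟩
  simp only [Matrix.mulVec_mulVec, ← Matrix.transpose_mul, ← Units.val_mul, inv_mul_cancel]
  simp

end ChangeOfVariables

/-! ### Convolutions of Schwartz functions -/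

section Convolution

variable {d : ℕ}

/-- The convolution of `f` with the pushforward of `g` under a linear map `T`, that is
`x ↦ ∫ f (x - T z) g z dz`. -/
noncomputable def linConv (f g : 𝓢(Space d, ℂ)) (T : Space d →L[ℝ] Space d) (x : Space d) : ℂ :=
  ∫ z, f (x - T z) * g z

theorem conv_coe_apply (f g : 𝓢(Space d, ℂ)) (x : Space d) :
    conv (f : 𝓢'(Space d, ℂ)) g x = ∫ y, g (x - y) * f y := by
  rw [conv, SchwartzMap.coe_apply]
  refine integral_congr_ae (ae_of_all _ fun y => ?_)
  change g (-y - -x) • f y = g (x - y) * f y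
  rw [smul_eq_mul, neg_sub_neg]

theorem conv_coe_eq_convolution (f g : 𝓢(Space d, ℂ)) :
    conv (f : 𝓢'(Space d, ℂ)) g = convolution (ContinuousLinearMap.mul ℂ ℂ) f g := by
  ext x
  rw [conv_coe_apply, convolution_apply, MeasureTheory.convolution]
  exact integral_congr_ae (ae_of_all _ fun y => mul_comm _ _)

theorem fourier_convolution_mul (f g : 𝓢(Space d, ℂ)) (ξ : Space d) :
    (𝓕 (convolution (ContinuousLinearMap.mul ℂ ℂ) f g) : 𝓢(Space d, ℂ)) ξ =
      (𝓕 f : 𝓢(Space d, ℂ)) ξ * (𝓕 g : 𝓢(Space d, ℂ)) ξ := by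
  rw [fourier_convolution, pairing_apply_apply]
  rfl

/-- The Fourier transform of the convolution is the product, and Fourier inversion does the rest.
This is what discards all blocks away from the frequencies of the test function. -/
theorem conv_eq_zero_of_fourier (f g : 𝓢(Space d, ℂ))
    (h : ∀ ξ, (𝓕 f : 𝓢(Space d, ℂ)) ξ ≠ 0 → (𝓕 g : 𝓢(Space d, ℂ)) ξ = 0) :
    conv (f : 𝓢'(Space d, ℂ)) g = 0 := by
  have h0 : (𝓕 (convolution (ContinuousLinearMap.mul ℂ ℂ) f g) : 𝓢(Space d, ℂ)) = 0 := by
    ext ξ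
    rw [fourier_convolution_mul]
    by_cases hf : (𝓕 f : 𝓢(Space d, ℂ)) ξ = 0
    · simp [hf]
    · simp [h ξ hf]
  have h1 := FourierTransform.fourierInv_fourier_eq (E := 𝓢(Space d, ℂ)) (F := 𝓢(Space d, ℂ))
    (convolution (ContinuousLinearMap.mul ℂ ℂ) f g : 𝓢(Space d, ℂ))
  rw [h0, FourierTransform.fourierInv_zero] at h1
  rw [conv_coe_eq_convolution, ← h1]
  rfl

/-- One common frequency suffices: a continuous function of zero norm vanishes everywhere, hence so
does its Fourier transform. -/
theorem eLpNorm_conv_ne_zero (f g : 𝓢(Space d, ℂ)) {ξ : Space d}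
    (hf : (𝓕 f : 𝓢(Space d, ℂ)) ξ ≠ 0) (hg : (𝓕 g : 𝓢(Space d, ℂ)) ξ ≠ 0)
    {p : ℝ≥0∞} (hp : p ≠ 0) : eLpNorm (conv (f : 𝓢'(Space d, ℂ)) g) p volume ≠ 0 := by
  rw [conv_coe_eq_convolution]
  intro h
  rw [eLpNorm_eq_zero_iff (SchwartzMap.continuous _).aestronglyMeasurable hp] at h
  have h0 := ((SchwartzMap.continuous _).ae_eq_iff_eq volume continuous_zero).mp h
  have h1 : (convolution (ContinuousLinearMap.mul ℂ ℂ) f g : 𝓢(Space d, ℂ)) = 0 :=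
    DFunLike.coe_injective h0
  have h2 := fourier_convolution_mul f g ξ
  rw [h1, FourierTransform.fourier_zero] at h2
  exact mul_ne_zero hf hg h2.symm

theorem eLpNorm_conv_lt_top (f g : 𝓢(Space d, ℂ)) (p : ℝ≥0∞) :
    eLpNorm (conv (f : 𝓢'(Space d, ℂ)) g) p volume < ⊤ := by
  rw [conv_coe_eq_convolution]
  exact (SchwartzMap.memLp (convolution (ContinuousLinearMap.mul ℂ ℂ) f g) p volume).2

theorem conv_smul (a : ℂ) (f : 𝓢'(Space d, ℂ)) (g : 𝓢(Space d, ℂ)) :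
    conv (a • f) g = a • conv f g := rfl

/-- Pointwise decay of `linConv f g T`, uniform in `‖T‖ ≤ R`. -/
theorem exists_linConv_bound (f g : 𝓢(Space d, ℂ)) (R : ℝ) (k : ℕ) :
    ∃ K : ℝ, 0 ≤ K ∧ ∃ b : Space d → ℝ, Integrable b ∧ ∀ T : Space d →L[ℝ] Space d, ‖T‖ ≤ R →
      (∀ x z, (1 + ‖x‖) ^ k * ‖f (x - T z) * g z‖ ≤ b z) ∧
      ∀ x, ‖linConv f g T x‖ ≤ K * (1 + ‖x‖) ^ (-(k : ℝ)) := by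
  obtain ⟨Cf, hCf⟩ : ∃ C : ℝ, ∀ x, (1 + ‖x‖) ^ k * ‖f x‖ ≤ C := by
    exact ⟨_, fun x => by
      simpa using one_add_le_sup_seminorm_apply (𝕜 := ℝ) (m := (k, 0)) (le_refl k) (le_refl 0) f x⟩
  -- Of the decay of `g`, `k` powers pay for moving the weight from `x` to `x - T z`; the other `d +
  -- 1` make the majorant integrable.
  obtain ⟨Cg, hCg⟩ : ∃ C : ℝ, ∀ x, (1 + ‖x‖) ^ (k + (d + 1)) * ‖g x‖ ≤ C := by
    exact ⟨_, fun x => by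
      simpa using one_add_le_sup_seminorm_apply (𝕜 := ℝ) (m := (k + (d + 1), 0)) le_rfl
        (le_refl 0) g x⟩
  have hCf0 : 0 ≤ Cf := le_trans (by positivity) (hCf 0)
  have hCg0 : 0 ≤ Cg := le_trans (by positivity) (hCg 0)
  set R' : ℝ := 1 + |R|
  have hR' : 1 ≤ R' := by simp [R']
  set b : Space d → ℝ := fun z => Cf * R' ^ k * Cg * (1 + ‖z‖) ^ (-((d + 1 : ℕ) : ℝ))
  have hb : Integrable b :=
    (integrable_one_add_norm (by rw [finrank_euclideanSpace_fin]; push_cast; linarith)).const_mul _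
  have hmain : ∀ T : Space d →L[ℝ] Space d, ‖T‖ ≤ R →
      ∀ x z, (1 + ‖x‖) ^ k * ‖f (x - T z) * g z‖ ≤ b z := by
    intro T hT x z
    have hTz : ‖T z‖ ≤ |R| * ‖z‖ := (T.le_opNorm z).trans
      (mul_le_mul_of_nonneg_right (hT.trans (le_abs_self R)) (norm_nonneg z))
    -- Peetre's inequality, with `R'` absorbing the norm of `T`.
    have h1 : 1 + ‖x‖ ≤ (1 + ‖x - T z‖) * (R' * (1 + ‖z‖)) := by
      have h2 : ‖x‖ ≤ ‖x - T z‖ + ‖T z‖ := by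
        simpa using norm_add_le (x - T z) (T z)
      have h3 : 1 + ‖T z‖ ≤ R' * (1 + ‖z‖) := by
        simp only [R']
        nlinarith [norm_nonneg z, abs_nonneg R]
      nlinarith [norm_nonneg (x - T z), norm_nonneg (T z)]
    have hz : 0 < 1 + ‖z‖ := by positivity
    have h4 : (1 + ‖z‖) ^ k * ‖g z‖ ≤ Cg * (1 + ‖z‖) ^ (-((d + 1 : ℕ) : ℝ)) := by
      rw [Real.rpow_neg hz.le, Real.rpow_natCast, ← div_eq_mul_inv, le_div_iff₀ (by positivity)]
      calc _ = (1 + ‖z‖) ^ (k + (d + 1)) * ‖g z‖ := by rw [pow_add]; ring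
        _ ≤ Cg := hCg z
    calc (1 + ‖x‖) ^ k * ‖f (x - T z) * g z‖
        ≤ ((1 + ‖x - T z‖) * (R' * (1 + ‖z‖))) ^ k * ‖f (x - T z) * g z‖ := by gcongr
      _ = R' ^ k * ((1 + ‖x - T z‖) ^ k * ‖f (x - T z)‖) * ((1 + ‖z‖) ^ k * ‖g z‖) := by
          rw [norm_mul, mul_pow, mul_pow]; ring
      _ ≤ R' ^ k * Cf * (Cg * (1 + ‖z‖) ^ (-((d + 1 : ℕ) : ℝ))) := by
          gcongr
          exact hCf _
      _ = b z := by simp only [b]; ring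
  have hb0 : ∀ z, 0 ≤ b z := fun z => by positivity
  refine ⟨∫ z, b z, integral_nonneg hb0, b, hb, fun T hT => ⟨hmain T hT, fun x => ?_⟩⟩
  have hx : 0 < 1 + ‖x‖ := by positivity
  rw [Real.rpow_neg hx.le, Real.rpow_natCast, ← div_eq_mul_inv, ← integral_div]
  refine norm_integral_le_of_norm_le (hb.div_const _) (ae_of_all _ fun z => ?_)
  rw [le_div_iff₀ (by positivity), mul_comm]
  exact hmain T hT x z

/-- This replaces Young's inequality, which is unavailable for `p < 1`: pointwise decay of order
`k`, with `k` large depending on `p`, controls every `L^p` quasi-norm. -/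
theorem exists_eLpNorm_linConv_le (f g : 𝓢(Space d, ℂ)) (R : ℝ) (p : ℝ≥0∞) :
    ∃ C : ℝ, 0 ≤ C ∧ ∀ T : Space d →L[ℝ] Space d, ‖T‖ ≤ R →
      eLpNorm (linConv f g T) p volume ≤ ENNReal.ofReal C := by
  obtain ⟨k, hk⟩ :=
    Measure.HasTemperateGrowth.exists_eLpNorm_lt_top (μ := (volume : Measure (Space d))) p
      inferInstance
  obtain ⟨K, hK, _, _, h⟩ := exists_linConv_bound f g R k
  have hlt : eLpNorm (K • fun x : Space d => (1 + ‖x‖) ^ (-(k : ℝ))) p volume < ⊤ := by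
    rw [eLpNorm_const_smul]
    exact ENNReal.mul_lt_top (by simp) hk
  refine ⟨(eLpNorm (K • fun x : Space d => (1 + ‖x‖) ^ (-(k : ℝ))) p volume).toReal,
    ENNReal.toReal_nonneg, fun T hT => ?_⟩
  rw [ENNReal.ofReal_toReal hlt.ne]
  exact eLpNorm_mono_real fun x => (h T hT).2 x

theorem continuous_linConv (f g : 𝓢(Space d, ℂ)) (T : Space d →L[ℝ] Space d) :
    Continuous (linConv f g T) := by
  obtain ⟨K, hK, b, hb, h⟩ := exists_linConv_bound f g ‖T‖ 0
  refine continuous_of_dominated (bound := b) (fun x => ?_) (fun x => ae_of_all _ fun z => ?_) hb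
    (ae_of_all _ fun z => ?_)
  · exact ((f.continuous.comp (by fun_prop)).mul g.continuous).aestronglyMeasurable
  · simpa using (h T le_rfl).1 x z
  · exact (f.continuous.comp (by fun_prop)).mul continuous_const

theorem tendsto_linConv (f g : 𝓢(Space d, ℂ)) {T : ℕ → Space d →L[ℝ] Space d}
    {L : Space d →L[ℝ] Space d} {R : ℝ} (hR : ∀ n, ‖T n‖ ≤ R)
    (hT : ∀ z, Tendsto (fun n => T n z) atTop (𝓝 (L z))) (x : Space d) :
    Tendsto (fun n => linConv f g (T n) x) atTop (𝓝 (linConv f g L x)) := by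
  obtain ⟨K, hK, b, hb, h⟩ := exists_linConv_bound f g R 0
  refine tendsto_integral_of_dominated_convergence b (fun n => ?_) hb
    (fun n => ae_of_all _ fun z => ?_) (ae_of_all _ fun z => ?_)
  · exact ((f.continuous.comp (by fun_prop)).mul g.continuous).aestronglyMeasurable
  · simpa using (h (T n) (hR n)).1 x z
  · exact ((f.continuous.tendsto _).comp (tendsto_const_nhds.sub (hT z))).mul tendsto_const_nhds

/-- A convolution of dilates is a dilate of some `linConv f g T`. -/
theorem conv_compMat_dilate (M N : GL (Fin d) ℝ) (f g : 𝓢(Space d, ℂ)) (x : Space d) :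
    conv (compMat M f : 𝓢'(Space d, ℂ)) (dilate N g) x =
      linConv f g (matAct (M * N⁻¹) : Space d →L[ℝ] Space d) (matAct M x) := by
  have hdet : |(N : Matrix (Fin d) (Fin d) ℝ).det| ≠ 0 := abs_ne_zero.mpr (det_ne_zero N)
  rw [conv_coe_apply, ← integral_sub_left_eq_self _ volume x, linConv,
    ← smul_inv_smul₀ hdet (∫ z : Space d, f (_ - _) * g z),
    ← integral_comp_matAct N (fun z => f (matAct M x - (matAct (M * N⁻¹) : Space d →L[ℝ] Space d) z) * g z),
    ← integral_smul]
  refine integral_congr_ae (ae_of_all _ fun y => ?_)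
  change (|(N : Matrix (Fin d) (Fin d) ℝ).det| • g (matAct N (x - (x - y)))) * f (matAct M (x - y)) =
    |(N : Matrix (Fin d) (Fin d) ℝ).det| •
      (f (matAct M x - matAct (M * N⁻¹) (matAct N y)) * g (matAct N y))
  rw [matAct_mul M N⁻¹, matAct_inv_matAct, ← map_sub, sub_sub_cancel, smul_mul_assoc, mul_comm]

/-- Separates the exact scaling, a power of `|det M|`, from a factor depending only on the relative
dilation `M N⁻¹`. -/
theorem eLpNorm_conv_compMat_dilate (M N : GL (Fin d) ℝ) (f g : 𝓢(Space d, ℂ)) (p : ℝ≥0∞) :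
    eLpNorm (conv (compMat M f : 𝓢'(Space d, ℂ)) (dilate N g)) p volume =
      ENNReal.ofReal (|(M : Matrix (Fin d) (Fin d) ℝ).det| ^ (-(p⁻¹).toReal)) *
        eLpNorm (linConv f g (matAct (M * N⁻¹) : Space d →L[ℝ] Space d)) p volume := by
  rw [← eLpNorm_comp_matAct M (continuous_linConv f g _)]
  congr 1
  ext x
  exact conv_compMat_dilate M N f g x

theorem dilate_one (g : 𝓢(Space d, ℂ)) : dilate 1 g = g := by
  ext x
  change |((1 : GL (Fin d) ℝ) : Matrix (Fin d) (Fin d) ℝ).det| • g (matAct 1 x) = g x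
  simp [matAct_one]

end Convolution

end Shearlet

namespace Shearlet

/-! ### Sequence norms -/

section SequenceNorm

variable {ι : Type}

theorem lqNorm_const_mul {q : ℝ≥0∞} (hq : 0 < q) (c : ℝ≥0∞) (a : ι → ℝ≥0∞) :
    lqNorm q (fun n => c * a n) = c * lqNorm q a := by
  unfold lqNorm
  split_ifs with h
  · rw [ENNReal.mul_iSup]
  · have hq' : 0 < q.toReal := ENNReal.toReal_pos hq.ne' h
    simp_rw [ENNReal.mul_rpow_of_nonneg _ _ hq'.le]
    rw [ENNReal.tsum_mul_left, ENNReal.mul_rpow_of_nonneg _ _ (by positivity), ← ENNReal.rpow_mul,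
      mul_one_div_cancel hq'.ne', ENNReal.rpow_one]

theorem le_lqNorm {q : ℝ≥0∞} (hq : 0 < q) (a : ι → ℝ≥0∞) (n : ι) : a n ≤ lqNorm q a := by
  unfold lqNorm
  split_ifs with h
  · exact le_iSup a n
  · have hq' : 0 < q.toReal := ENNReal.toReal_pos hq.ne' h
    calc a n = (a n ^ q.toReal) ^ (1 / q.toReal) := by
          rw [← ENNReal.rpow_mul, mul_one_div_cancel hq'.ne', ENNReal.rpow_one]
      _ ≤ _ := by
          gcongr
          exact ENNReal.le_tsum n

theorem lqNorm_le_of_finset {q : ℝ≥0∞} (hq : 0 < q) {a : ι → ℝ≥0∞} {s : Finset ι} {M : ℝ≥0∞}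
    (hs : ∀ n, n ∉ s → a n = 0) (hM : ∀ n ∈ s, a n ≤ M) :
    lqNorm q a ≤ (s.card : ℝ≥0∞) ^ (1 / q.toReal) * M := by
  unfold lqNorm
  split_ifs with h
  · subst h
    -- For `q = ∞` the exponent `1 / q.toReal` is `1 / 0 = 0`, so the cardinality factor is `1`, as
    -- it should be for a supremum.
    simp only [ENNReal.toReal_top, div_zero, ENNReal.rpow_zero, one_mul]
    refine iSup_le fun n => ?_
    by_cases hn : n ∈ s
    · exact hM n hn
    · simp [hs n hn]
  · have hq' : 0 < q.toReal := ENNReal.toReal_pos hq.ne' h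
    have h1 : ∑' n, a n ^ q.toReal ≤ s.card * M ^ q.toReal := by
      rw [tsum_eq_sum (s := s) fun n hn => by simp [hs n hn, hq']]
      calc ∑ n ∈ s, a n ^ q.toReal ≤ ∑ _n ∈ s, M ^ q.toReal :=
            Finset.sum_le_sum fun n hn => ENNReal.rpow_le_rpow (hM n hn) hq'.le
        _ = s.card * M ^ q.toReal := by simp
    calc (∑' n, a n ^ q.toReal) ^ (1 / q.toReal)
        ≤ (s.card * M ^ q.toReal) ^ (1 / q.toReal) := ENNReal.rpow_le_rpow h1 (by positivity)
      _ = _ := by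
        rw [ENNReal.mul_rpow_of_nonneg _ _ (by positivity), ← ENNReal.rpow_mul,
          mul_one_div_cancel hq'.ne', ENNReal.rpow_one]

theorem lqNorm_lt_top_of_finset {q : ℝ≥0∞} (hq : 0 < q) {a : ι → ℝ≥0∞} {s : Finset ι}
    (hs : ∀ n, n ∉ s → a n = 0) (ha : ∀ n ∈ s, a n < ⊤) : lqNorm q a < ⊤ := by
  refine (lqNorm_le_of_finset hq hs fun n hn => Finset.single_le_sum (fun _ _ => zero_le) hn).trans_lt
    (ENNReal.mul_lt_top (ENNReal.rpow_lt_top_of_nonneg (by positivity) (by simp)) ?_)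
  exact ENNReal.sum_lt_top.mpr ha

end SequenceNorm

/-! ### Homogeneity and normalisation -/

section Homogeneity

variable {d : ℕ}

theorem besovNorm_smul (Φ φ : 𝓢(Space d, ℂ)) (α : ℝ) (p : ℝ≥0∞) {q : ℝ≥0∞} (hq : 0 < q) (a : ℂ)
    (f : 𝓢'(Space d, ℂ)) :
    besovNorm Φ φ α p q (a • f) = ‖a‖ₑ * besovNorm Φ φ α p q f := by
  simp only [besovNorm, conv_smul, eLpNorm_const_smul, mul_add, ← lqNorm_const_mul hq]
  simp only [mul_left_comm]

theorem besovABNorm_smul (S : Generators d) (α : ℝ) (p : ℝ≥0∞) {q : ℝ≥0∞} (hq : 0 < q) (a : ℂ)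
    (f : 𝓢'(Space d, ℂ)) :
    besovABNorm S α p q (a • f) = ‖a‖ₑ * besovABNorm S α p q f := by
  simp only [besovABNorm, conv_smul, eLpNorm_const_smul, mul_add, ← lqNorm_const_mul hq]
  simp only [mul_left_comm]

/-- If the ratio of the two norms along `F` decays geometrically, then suitable multiples of the
`F j` are normalised in the shearlet norm and tend to zero in the classical norm. -/
theorem exists_normalization (S : Generators d) (Φ φ : 𝓢(Space d, ℂ)) {α₁ α₂ : ℝ}
    {p₁ p₂ q₁ q₂ : ℝ≥0∞} (hq₁ : 0 < q₁) (hq₂ : 0 < q₂) (F : ℕ → 𝓢(Space d, ℂ))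
    (h0 : ∀ j, besovABNorm S α₂ p₂ q₂ (F j : 𝓢'(Space d, ℂ)) ≠ 0)
    (htop : ∀ j, besovABNorm S α₂ p₂ q₂ (F j : 𝓢'(Space d, ℂ)) < ⊤)
    {β γ c C : ℝ} (hc : 0 < c) (hγβ : γ < β)
    (hlow : ∀ᶠ j : ℕ in atTop, ENNReal.ofReal (c * 2 ^ (β * j)) ≤
      besovABNorm S α₂ p₂ q₂ (F j : 𝓢'(Space d, ℂ)))
    (hup : ∀ᶠ j : ℕ in atTop, besovNorm Φ φ α₁ p₁ q₁ (F j : 𝓢'(Space d, ℂ)) ≤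
      ENNReal.ofReal (C * 2 ^ (γ * j))) :
    ∃ a : ℕ → ℂ,
      (∀ j, besovABNorm S α₂ p₂ q₂ ((a j • F j : 𝓢(Space d, ℂ)) : 𝓢'(Space d, ℂ)) = 1) ∧
      Tendsto (fun j => besovNorm Φ φ α₁ p₁ q₁
        ((a j • F j : 𝓢(Space d, ℂ)) : 𝓢'(Space d, ℂ))) atTop (𝓝 0) := by
  set N : ℕ → ℝ≥0∞ := fun j => besovABNorm S α₂ p₂ q₂ (F j : 𝓢'(Space d, ℂ))
  have hcoe : ∀ (a : ℂ) (g : 𝓢(Space d, ℂ)),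
      ((a • g : 𝓢(Space d, ℂ)) : 𝓢'(Space d, ℂ)) = a • (g : 𝓢'(Space d, ℂ)) := fun a g =>
    map_smul _ a g
  have hnorm : ∀ j, ‖(((N j).toReal⁻¹ : ℝ) : ℂ)‖ₑ = (N j)⁻¹ := by
    intro j
    have hpos : 0 < (N j).toReal := ENNReal.toReal_pos (h0 j) (htop j).ne
    rw [← ofReal_norm, Complex.norm_real, Real.norm_of_nonneg (by positivity),
      ENNReal.ofReal_inv_of_pos hpos, ENNReal.ofReal_toReal (htop j).ne]
  refine ⟨fun j => ((N j).toReal⁻¹ : ℝ), fun j => ?_, ?_⟩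
  · rw [hcoe, besovABNorm_smul S _ _ hq₂, hnorm]
    exact ENNReal.inv_mul_cancel (h0 j) (htop j).ne
  · have hgeo : Tendsto (fun j : ℕ => ENNReal.ofReal (C / c * (2 ^ (γ - β)) ^ j)) atTop (𝓝 0) := by
      have h1 : Tendsto (fun j : ℕ => C / c * ((2 : ℝ) ^ (γ - β)) ^ j) atTop (𝓝 (C / c * 0)) :=
        (tendsto_pow_atTop_nhds_zero_of_lt_one (by positivity)
          (Real.rpow_lt_one_of_one_lt_of_neg one_lt_two (by linarith))).const_mul _
      simpa using ENNReal.tendsto_ofReal h1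
    refine tendsto_of_tendsto_of_tendsto_of_le_of_le' tendsto_const_nhds hgeo
      (Eventually.of_forall fun _ => zero_le) ?_
    filter_upwards [hlow, hup] with j hl hu
    rw [hcoe, besovNorm_smul _ _ _ _ hq₁, hnorm]
    have hpos : 0 < c * 2 ^ (β * j) := by positivity
    calc (N j)⁻¹ * besovNorm Φ φ α₁ p₁ q₁ (F j : 𝓢'(Space d, ℂ))
        ≤ (ENNReal.ofReal (c * 2 ^ (β * j)))⁻¹ * ENNReal.ofReal (C * 2 ^ (γ * j)) := by gcongr
      _ = ENNReal.ofReal (C / c * (2 ^ (γ - β)) ^ j) := by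
        rw [← ENNReal.ofReal_inv_of_pos hpos, ← ENNReal.ofReal_mul (by positivity)]
        congr 1
        rw [← Real.rpow_natCast, ← Real.rpow_mul zero_le_two, sub_mul, Real.rpow_sub two_pos]
        field_simp

end Homogeneity

/-! ### Diagonal matrices -/

section Diagonal

variable {d : ℕ}

theorem coe_diagGL (v : Fin d → ℝ) (hv : ∀ k, v k ≠ 0) :
    (diagGL v hv : Matrix (Fin d) (Fin d) ℝ) = Matrix.diagonal v := rfl

theorem coe_diagGL_pow (v : Fin d → ℝ) (hv : ∀ k, v k ≠ 0) (j : ℕ) :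
    ((diagGL v hv ^ j : GL (Fin d) ℝ) : Matrix (Fin d) (Fin d) ℝ) =
      Matrix.diagonal fun k => v k ^ j := by
  rw [Units.val_pow_eq_pow_val, coe_diagGL, Matrix.diagonal_pow]
  rfl

theorem coe_anisoA_pow (i : Fin d) (j : ℕ) :
    ((anisoA i ^ j : GL (Fin d) ℝ) : Matrix (Fin d) (Fin d) ℝ) =
      Matrix.diagonal fun k => (if k = i then (4 : ℝ) else 2) ^ j :=
  coe_diagGL_pow _ _ j

theorem det_anisoA_pow (i : Fin d) (j : ℕ) :
    ((anisoA i ^ j : GL (Fin d) ℝ) : Matrix (Fin d) (Fin d) ℝ).det = 2 ^ (((d : ℝ) + 1) * j) := by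
  have h : ∀ k : Fin d, (if k = i then (4 : ℝ) else 2) = 2 * if k = i then 2 else 1 := by
    intro k
    split_ifs <;> norm_num
  rw [coe_anisoA_pow, Matrix.det_diagonal, Finset.prod_pow]
  simp_rw [h]
  rw [Finset.prod_mul_distrib, Finset.prod_const, Finset.prod_ite_eq' Finset.univ i fun _ => (2 : ℝ),
    if_pos (Finset.mem_univ i), Finset.card_univ, Fintype.card_fin, ← pow_succ, ← pow_mul,
    ← Real.rpow_natCast]
  push_cast
  rfl

theorem matAct_dyadicI_pow (ν : ℕ) (x : Space d) : matAct (dyadicI d ^ ν) x = (2 : ℝ) ^ ν • x := by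
  ext k
  rw [matAct_apply, dyadicI, coe_diagGL_pow]
  simp [Matrix.mulVec_diagonal]

theorem norm_le_mul_of_abs_le {x y : Space d} {c : ℝ} (hc : 0 ≤ c) (h : ∀ k, |x k| ≤ c * |y k|) :
    ‖x‖ ≤ c * ‖y‖ := by
  rw [EuclideanSpace.norm_eq, EuclideanSpace.norm_eq,
    ← Real.sqrt_sq hc, ← Real.sqrt_mul (sq_nonneg c), Finset.mul_sum]
  refine Real.sqrt_le_sqrt (Finset.sum_le_sum fun k _ => ?_)
  rw [← mul_pow]
  exact pow_le_pow_left₀ (norm_nonneg _) (h k) 2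

theorem norm_le_card_mul {x : Space d} {c : ℝ} (hc : 0 ≤ c) (h : ∀ k, |x k| ≤ c) :
    ‖x‖ ≤ d * c := by
  rw [EuclideanSpace.norm_eq]
  refine Real.sqrt_le_iff.mpr ⟨by positivity, ?_⟩
  calc ∑ k, ‖x k‖ ^ 2 ≤ ∑ _k : Fin d, c ^ 2 :=
        Finset.sum_le_sum fun k _ => pow_le_pow_left₀ (norm_nonneg _) (h k) 2
    _ = d * c ^ 2 := by simp
    _ ≤ (d * c) ^ 2 := by
        rw [mul_pow]
        gcongr
        exact_mod_cast Nat.le_self_pow two_ne_zero d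

theorem abs_apply_le_norm (x : Space d) (k : Fin d) : |x k| ≤ ‖x‖ := by
  simpa using PiLp.norm_apply_le x k

theorem norm_matAct_anisoA_pow_le (i : Fin d) (j : ℕ) (x : Space d) :
    ‖matAct (anisoA i ^ j) x‖ ≤ 4 ^ j * ‖x‖ := by
  refine norm_le_mul_of_abs_le (by positivity) fun k => ?_
  rw [matAct_apply, coe_anisoA_pow]
  simp only [Matrix.mulVec_diagonal, abs_mul, abs_pow]
  gcongr
  split_ifs <;> norm_num

end Diagonal

end Shearlet

namespace Shearlet

/-! ### Frequency supports -/

section FrequencySupport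

variable {d : ℕ}

theorem dilate_eq_smul_compMat (N : GL (Fin d) ℝ) (g : 𝓢(Space d, ℂ)) :
    dilate N g = ((|(N : Matrix (Fin d) (Fin d) ℝ).det| : ℝ) : ℂ) • compMat N g := by
  ext x
  change |(N : Matrix (Fin d) (Fin d) ℝ).det| • compMat N g x =
    ((|(N : Matrix (Fin d) (Fin d) ℝ).det| : ℝ) : ℂ) • compMat N g x
  rw [Complex.coe_smul]

theorem fourier_dilate (N : GL (Fin d) ℝ) (g : 𝓢(Space d, ℂ)) (ξ : Space d) :
    (𝓕 (dilate N g) : 𝓢(Space d, ℂ)) ξ =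
      |(N : Matrix (Fin d) (Fin d) ℝ).det| * (𝓕 (compMat N g) : 𝓢(Space d, ℂ)) ξ := by
  rw [dilate_eq_smul_compMat, FourierTransform.fourier_smul]
  rfl

theorem fourier_compMat_transpose_ne_zero (N : GL (Fin d) ℝ) {g : 𝓢(Space d, ℂ)} {η : Space d} :
    (𝓕 (compMat N g) : 𝓢(Space d, ℂ))
      (WithLp.toLp 2 ((N : Matrix (Fin d) (Fin d) ℝ)ᵀ *ᵥ WithLp.ofLp η)) ≠ 0 ↔
      (𝓕 g : 𝓢(Space d, ℂ)) η ≠ 0 := by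
  have hdet : ((|(N : Matrix (Fin d) (Fin d) ℝ).det| : ℝ) : ℂ) ≠ 0 := by
    exact_mod_cast abs_ne_zero.mpr (det_ne_zero N)
  rw [← fourier_dilate_transpose N g η, fourier_dilate, mul_ne_zero_iff, and_iff_right hdet]

theorem IsDyadicPair.norm_le_of_fourier_ne_zero {Φ φ : 𝓢(Space d, ℂ)} (h : IsDyadicPair Φ φ)
    {ξ : Space d} (hξ : (𝓕 Φ : 𝓢(Space d, ℂ)) ξ ≠ 0) : ‖ξ‖ ≤ 2 :=
  h.supp_Φ (subset_tsupport _ hξ)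

theorem IsDyadicPair.norm_of_fourier_dilate_ne_zero {Φ φ : 𝓢(Space d, ℂ)} (h : IsDyadicPair Φ φ)
    (ν : ℕ) {ξ : Space d} (hξ : (𝓕 (dilate (dyadicI d ^ ν) φ) : 𝓢(Space d, ℂ)) ξ ≠ 0) :
    2 ^ ν ≤ 2 * ‖ξ‖ ∧ ‖ξ‖ ≤ 2 * 2 ^ ν := by
  obtain ⟨η, rfl⟩ := exists_transpose_mulVec (dyadicI d ^ ν) ξ
  rw [fourier_dilate_transpose] at hξ
  have hη := h.supp_φ (subset_tsupport _ hξ)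
  have h1 : WithLp.toLp 2 (((dyadicI d ^ ν : GL (Fin d) ℝ) : Matrix (Fin d) (Fin d) ℝ)ᵀ *ᵥ
      WithLp.ofLp η) = (2 : ℝ) ^ ν • η := by
    rw [← matAct_dyadicI_pow, matAct_apply, dyadicI, coe_diagGL_pow, Matrix.diagonal_transpose]
  rw [h1, norm_smul, Real.norm_of_nonneg (by positivity)]
  have h2 : (0 : ℝ) < 2 ^ ν := by positivity
  constructor <;> nlinarith [hη.1, hη.2]

namespace Generators

variable (S : Generators d)

theorem fourier_ψ (i : Fin d) (ξ : Space d) : (𝓕 (S.ψ i) : 𝓢(Space d, ℂ)) ξ = S.ψhat i ξ := by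
  rw [ψ, FourierTransform.fourier_fourierInv_eq]
  rfl

theorem abs_apply_of_ψhat_ne_zero {i : Fin d} {ξ : Space d} (h : S.ψhat i ξ ≠ 0) :
    1 / 16 ≤ |ξ i| ∧ |ξ i| ≤ 1 / 2 ∧ ∀ k, |ξ k| ≤ |ξ i| := by
  have h1 : S.ψhat1 (ξ i) ≠ 0 := left_ne_zero_of_mul h
  have hlow : 1 / 16 ≤ |ξ i| := by
    by_contra hlt
    exact h1 (S.ψhat1_eq_zero (Or.inl (not_le.mp hlt)))
  refine ⟨hlow, ?_, fun k => ?_⟩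
  · by_contra hlt
    exact h1 (S.ψhat1_eq_zero (Or.inr (not_le.mp hlt)))
  · by_cases hki : k = i
    · rw [hki]
    · have h2 := Finset.prod_ne_zero_iff.mp (right_ne_zero_of_mul h) k
        (Finset.mem_erase.mpr ⟨hki, Finset.mem_univ k⟩)
      have h3 : |ξ k / ξ i| ≤ 1 := by
        by_contra hlt
        exact h2 (S.ψhat2_eq_zero (not_le.mp hlt))
      rwa [abs_div, div_le_one (by linarith)] at h3

theorem exists_ψhat_ne_zero (i : Fin d) : ∃ ξ, S.ψhat i ξ ≠ 0 := by
  obtain ⟨s, hs⟩ : ∃ s, S.ψhat1 s ≠ 0 := by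
    by_contra! h
    have h1 := S.sum1 1 (by norm_num)
    simp only [h, norm_zero, ne_eq, OfNat.ofNat_ne_zero, not_false_eq_true, zero_pow] at h1
    exact zero_ne_one (hasSum_zero.unique h1)
  obtain ⟨t, ht⟩ : ∃ t, S.ψhat2 t ≠ 0 := by
    by_contra! h
    have h1 := S.sum2 0 (by norm_num)
    simp [h] at h1
  have hs0 : s ≠ 0 := by
    rintro rfl
    exact hs (S.ψhat1_eq_zero (Or.inl (by norm_num)))
  -- All ratios `ξ_k / ξ_i` with `k ≠ i` equal `t` at this point.
  refine ⟨WithLp.toLp 2 fun k => if k = i then s else t * s, ?_⟩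
  refine mul_ne_zero (by simpa using hs) (Finset.prod_ne_zero_iff.mpr fun k hk => ?_)
  simpa [(Finset.mem_erase.mp hk).1, hs0] using ht

/-- Column `i` of the shear matrix is a unit vector, so its transpose fixes the coordinate `i`,
which `A^j` then multiplies by `4^j`. Hence the bound is independent of `ℓ`. -/
theorem le_norm_of_fourier_dilate_ne_zero (i : Fin d) (j : ℕ) (ℓ : Fin d → ℤ) {ξ : Space d}
    (hξ : (𝓕 (dilate (shearB i ℓ * anisoA i ^ j) (S.ψ i)) : 𝓢(Space d, ℂ)) ξ ≠ 0) :
    4 ^ j / 16 ≤ ‖ξ‖ := by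
  obtain ⟨η, rfl⟩ := exists_transpose_mulVec (shearB i ℓ * anisoA i ^ j) ξ
  rw [fourier_dilate_transpose, fourier_ψ] at hξ
  refine le_trans ?_ (abs_apply_le_norm _ i)
  have h1 : (((shearB i ℓ * anisoA i ^ j : GL (Fin d) ℝ) : Matrix (Fin d) (Fin d) ℝ)ᵀ *ᵥ
      WithLp.ofLp η) i = 4 ^ j * η i := by
    rw [Units.val_mul, Matrix.transpose_mul, coe_anisoA_pow, Matrix.diagonal_transpose,
      ← Matrix.mulVec_mulVec, Matrix.mulVec_diagonal, if_pos rfl]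
    congr 1
    have h2 : ∀ a, shearMatrix i ℓ a i = if a = i then 1 else 0 := by
      intro a
      by_cases ha : a = i <;> simp [shearMatrix, ha]
    change (fun a => shearMatrix i ℓ a i) ⬝ᵥ WithLp.ofLp η = η i
    simp [dotProduct, h2]
  rw [PiLp.toLp_apply, h1, abs_mul, abs_of_pos (by positivity : (0 : ℝ) < 4 ^ j)]
  have := (S.abs_apply_of_ψhat_ne_zero hξ).1
  have h4 : (0 : ℝ) < 4 ^ j := by positivity
  nlinarith

theorem norm_of_fourier_compMat_anisoA_ne_zero (i : Fin d) (j : ℕ) {ξ : Space d}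
    (hξ : (𝓕 (compMat (anisoA i ^ j) (S.ψ i)) : 𝓢(Space d, ℂ)) ξ ≠ 0) :
    4 ^ j / 16 ≤ ‖ξ‖ ∧ ‖ξ‖ ≤ d * 4 ^ j := by
  obtain ⟨η, rfl⟩ := exists_transpose_mulVec (anisoA i ^ j) ξ
  rw [fourier_compMat_transpose_ne_zero, fourier_ψ] at hξ
  obtain ⟨h1, h2, h3⟩ := S.abs_apply_of_ψhat_ne_zero hξ
  have h4 : (0 : ℝ) < 4 ^ j := by positivity
  rw [coe_anisoA_pow, Matrix.diagonal_transpose]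
  constructor
  · refine le_trans ?_ (abs_apply_le_norm _ i)
    rw [PiLp.toLp_apply, Matrix.mulVec_diagonal, if_pos rfl, abs_mul, abs_of_pos h4]
    nlinarith
  · refine norm_le_card_mul h4.le fun k => ?_
    rw [PiLp.toLp_apply, Matrix.mulVec_diagonal, abs_mul, abs_pow]
    have h5 : |if k = i then (4 : ℝ) else 2| ^ j ≤ 4 ^ j := by
      gcongr
      split_ifs <;> norm_num
    have h6 : |η k| ≤ 1 := by linarith [h3 k]
    calc _ ≤ (4 : ℝ) ^ j * 1 := by gcongr
      _ = 4 ^ j := mul_one _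

end Generators

theorem finite_shearIndex_scale_lt (J : ℕ) : {n : ShearIndex d | n.2.1 < J}.Finite := by
  have hb : ∀ n : {n : ShearIndex d | n.2.1 < J}, ∀ k,
      n.1.2.2.1 k ∈ Set.Icc (-(2 : ℤ) ^ J) (2 ^ J) := fun n k =>
    abs_le.mp ((n.1.2.2.2.2 k).trans (pow_le_pow_right₀ one_le_two (le_of_lt n.2)))
  let e : {n : ShearIndex d | n.2.1 < J} →
      Fin d × Fin J × (Fin d → Set.Icc (-(2 : ℤ) ^ J) (2 ^ J)) :=
    fun n => (n.1.1, ⟨n.1.2.1, n.2⟩, fun k => ⟨n.1.2.2.1 k, hb n k⟩)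
  suffices he : Function.Injective e from
    have := Finite.of_injective e he
    Set.toFinite _
  rintro ⟨⟨i, j, ℓ, hℓ⟩, hj⟩ ⟨⟨i', j', ℓ', hℓ'⟩, hj'⟩ h
  simp only [e, Prod.mk.injEq, Fin.mk.injEq] at h
  obtain ⟨rfl, rfl, h⟩ := h
  obtain rfl : ℓ = ℓ' := by
    ext k
    exact congrArg Subtype.val (congrFun h k)
  rfl

/-- Band-limited Schwartz functions belong to every shearlet Besov space. -/
theorem besovABNorm_lt_top (S : Generators d) (α : ℝ) (p : ℝ≥0∞) {q : ℝ≥0∞} (hq : 0 < q)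
    (f : 𝓢(Space d, ℂ)) {R : ℝ} (hf : ∀ ξ, (𝓕 f : 𝓢(Space d, ℂ)) ξ ≠ 0 → ‖ξ‖ ≤ R) :
    besovABNorm S α p q (f : 𝓢'(Space d, ℂ)) < ⊤ := by
  -- Shearlets of scale at least `J` live at frequencies `‖ξ‖ ≥ 4^J / 16 > R`, off the spectrum of
  -- `f`.
  obtain ⟨J, hJ⟩ := pow_unbounded_of_one_lt (16 * R) (by norm_num : (1 : ℝ) < 4)
  refine ENNReal.add_lt_top.mpr ⟨eLpNorm_conv_lt_top _ _ _, ?_⟩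
  refine lqNorm_lt_top_of_finset hq (s := (finite_shearIndex_scale_lt J).toFinset) ?_ fun n _ =>
    ENNReal.mul_lt_top ENNReal.ofReal_lt_top (eLpNorm_conv_lt_top _ _ _)
  intro n hn
  simp only [Set.Finite.mem_toFinset, Set.mem_ofPred_eq, not_lt] at hn
  have h0 : conv (f : 𝓢'(Space d, ℂ))
      (dilate (shearB n.1 n.2.2.1 * anisoA n.1 ^ n.2.1) (S.ψ n.1)) = 0 := by
    refine conv_eq_zero_of_fourier _ _ fun ξ hξ => ?_
    by_contra hne
    have h1 := S.le_norm_of_fourier_dilate_ne_zero _ _ _ hne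
    have h2 := hf ξ hξ
    have h3 : (4 : ℝ) ^ J ≤ 4 ^ n.2.1 := pow_le_pow_right₀ (by norm_num) hn
    linarith
  rw [h0, eLpNorm_zero, mul_zero]

end FrequencySupport

end Shearlet

namespace Shearlet

/-! ### Single shearlets -/

section SingleShearlet

variable {d : ℕ}

theorem compMat_one (g : 𝓢(Space d, ℂ)) : compMat 1 g = g := by
  ext x
  change g (matAct 1 x) = g x
  rw [matAct_one]

theorem linConv_matAct_one (f g : 𝓢(Space d, ℂ)) :
    linConv f g (matAct (1 : GL (Fin d) ℝ) : Space d →L[ℝ] Space d) = conv (f : 𝓢'(Space d, ℂ)) g := by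
  ext x
  have h := conv_compMat_dilate 1 1 f g x
  rw [compMat_one, dilate_one, matAct_one, inv_one, mul_one] at h
  exact h.symm

theorem shearB_zero (i : Fin d) : shearB i 0 = 1 := by
  ext a b
  by_cases hab : a = b <;> simp [shearB, shearMatrix, hab]

theorem abs_det_anisoA_pow_rpow (i : Fin d) (j : ℕ) (s : ℝ) :
    |((anisoA i ^ j : GL (Fin d) ℝ) : Matrix (Fin d) (Fin d) ℝ).det| ^ s =
      2 ^ (((d : ℝ) + 1) * s * j) := by
  rw [det_anisoA_pow, abs_of_pos (by positivity), ← Real.rpow_mul zero_le_two]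
  ring_nf

namespace Generators

variable (S : Generators d)

theorem shearlet_zero_zero (i : Fin d) (j : ℕ) :
    S.shearlet i j 0 0 =
      (((2 : ℝ) ^ (((d : ℝ) + 1) * (1 / 2) * j) : ℝ) : ℂ) • compMat (anisoA i ^ j) (S.ψ i) := by
  have h0 : (WithLp.toLp 2 fun n => (((0 : Fin d → ℤ) n : ℤ) : ℝ)) = (0 : Space d) := by
    ext k
    simp
  have h1 : |(anisoA i : Matrix (Fin d) (Fin d) ℝ).det| ^ ((j : ℝ) / 2) =
      2 ^ (((d : ℝ) + 1) * (1 / 2) * j) := by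
    have h2 := abs_det_anisoA_pow_rpow i 1 ((j : ℝ) / 2)
    rw [pow_one] at h2
    rw [h2]
    push_cast
    ring_nf
  rw [shearlet, h0, compSubConstCLM_zero, shearB_zero, one_mul, h1]
  ext x
  change (2 : ℝ) ^ (((d : ℝ) + 1) * (1 / 2) * j) • compMat (anisoA i ^ j) (S.ψ i) x =
    (((2 : ℝ) ^ (((d : ℝ) + 1) * (1 / 2) * j) : ℝ) : ℂ) • compMat (anisoA i ^ j) (S.ψ i) x
  rw [Complex.coe_smul]

/-- Only the term with the same `i` and `j` and with `ℓ = 0` is kept. There the relative dilation is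
the identity, so the constant is `‖ψ^{(i)} ∗ ψ^{(i)}‖_p` at every scale. -/
theorem exists_le_besovABNorm_compMat (i : Fin d) (α : ℝ) {p q : ℝ≥0∞} (hp : 0 < p) (hq : 0 < q) :
    ∃ c : ℝ, 0 < c ∧ ∀ j : ℕ,
      ENNReal.ofReal (c * 2 ^ (((d : ℝ) + 1) * (α - (p⁻¹).toReal) * j)) ≤
        besovABNorm S α p q (compMat (anisoA i ^ j) (S.ψ i) : 𝓢'(Space d, ℂ)) := by
  obtain ⟨ξ, hξ⟩ := S.exists_ψhat_ne_zero i
  have hξ' : (𝓕 (S.ψ i) : 𝓢(Space d, ℂ)) ξ ≠ 0 := by rwa [fourier_ψ]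
  have hne := eLpNorm_conv_ne_zero (S.ψ i) (S.ψ i) hξ' hξ' hp.ne'
  have hlt := eLpNorm_conv_lt_top (S.ψ i) (S.ψ i) p
  refine ⟨_, ENNReal.toReal_pos hne hlt.ne, fun j => ?_⟩
  have hle := le_lqNorm hq (fun n : ShearIndex d =>
    ENNReal.ofReal (volQ d n.2.1 ^ (-α)) *
      eLpNorm (conv (compMat (anisoA i ^ j) (S.ψ i) : 𝓢'(Space d, ℂ))
        (dilate (shearB n.1 n.2.2.1 * anisoA n.1 ^ n.2.1) (S.ψ n.1))) p volume)
    ⟨i, j, ⟨0, rfl, fun k => by simp⟩⟩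
  refine le_trans (le_of_eq ?_) (hle.trans le_add_self)
  dsimp only
  rw [shearB_zero, one_mul, eLpNorm_conv_compMat_dilate, mul_inv_cancel, linConv_matAct_one,
    abs_det_anisoA_pow_rpow, ENNReal.ofReal_mul ENNReal.toReal_nonneg, ENNReal.ofReal_toReal hlt.ne,
    mul_comm, ← mul_assoc, ← ENNReal.ofReal_mul (by unfold volQ; positivity), volQ,
    ← Real.rpow_mul zero_le_two, ← Real.rpow_add two_pos]
  ring_nf

end Generators

theorem norm_matAct_mul_dyadicI_inv_le (i : Fin d) {j ν : ℕ} (h : 2 * j ≤ ν + 5) :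
    ‖(matAct (anisoA i ^ j * (dyadicI d ^ ν)⁻¹) : Space d →L[ℝ] Space d)‖ ≤ 2 ^ 5 := by
  refine ContinuousLinearMap.opNorm_le_bound _ (by positivity) fun x => ?_
  change ‖matAct (anisoA i ^ j * (dyadicI d ^ ν)⁻¹) x‖ ≤ _
  set y := matAct (dyadicI d ^ ν)⁻¹ x with hy
  have hx : x = (2 : ℝ) ^ ν • y := by rw [hy, ← matAct_dyadicI_pow, matAct_matAct_inv]
  rw [matAct_mul, ← hy, hx, norm_smul, Real.norm_of_nonneg (by positivity), ← mul_assoc, ← pow_add]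
  refine (norm_matAct_anisoA_pow_le i j y).trans (mul_le_mul_of_nonneg_right ?_ (norm_nonneg y))
  rw [show (4 : ℝ) = 2 ^ 2 by norm_num, ← pow_mul]
  exact pow_le_pow_right₀ one_le_two (by omega)

theorem Generators.exists_besovNorm_compMat_le (S : Generators d) {Φ φ : 𝓢(Space d, ℂ)}
    (hφ : IsDyadicPair Φ φ) (i : Fin d) (α : ℝ) (p : ℝ≥0∞) {q : ℝ≥0∞} (hq : 0 < q) :
    ∃ C : ℝ, ∀ᶠ j : ℕ in atTop,
      besovNorm Φ φ α p q (compMat (anisoA i ^ j) (S.ψ i) : 𝓢'(Space d, ℂ)) ≤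
        ENNReal.ofReal (C * 2 ^ ((2 * α - ((d : ℝ) + 1) * (p⁻¹).toReal) * j)) := by
  obtain ⟨C, hC, hlin⟩ := exists_eLpNorm_linConv_le (S.ψ i) φ (2 ^ 5) p
  refine ⟨((d : ℝ) + 7) ^ (1 / q.toReal) * (2 ^ (((d : ℝ) + 5) * |α|) * C), ?_⟩
  -- From `j = 3` on, `4^j / 16 ≥ 4 > 2`, so `Φ` sees nothing, and the natural number subtraction `2
  -- * j - 5` is not truncated.
  filter_upwards [eventually_ge_atTop 3] with j hj
  have h4 : (4 : ℝ) ^ j = 2 ^ (2 * j) := by rw [pow_mul]; norm_num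
  have hlowfreq : conv (compMat (anisoA i ^ j) (S.ψ i) : 𝓢'(Space d, ℂ)) Φ = 0 := by
    refine conv_eq_zero_of_fourier _ _ fun ξ hξ => ?_
    by_contra hne
    have h1 := (S.norm_of_fourier_compMat_anisoA_ne_zero i j hξ).1
    have h2 := hφ.norm_le_of_fourier_ne_zero hne
    have h3 : (4 : ℝ) ^ 3 ≤ 4 ^ j := pow_le_pow_right₀ (by norm_num) hj
    linarith
  have hvanish : ∀ ν : ℕ, ν ∉ Finset.Icc (2 * j - 5) (2 * j + d + 1) →
      conv (compMat (anisoA i ^ j) (S.ψ i) : 𝓢'(Space d, ℂ)) (dilate (dyadicI d ^ ν) φ) = 0 := by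
    intro ν hν
    refine conv_eq_zero_of_fourier _ _ fun ξ hξ => ?_
    by_contra hne
    obtain ⟨h1, h2⟩ := S.norm_of_fourier_compMat_anisoA_ne_zero i j hξ
    obtain ⟨h3, h5⟩ := hφ.norm_of_fourier_dilate_ne_zero ν hne
    refine hν (Finset.mem_Icc.mpr ⟨?_, ?_⟩)
    · have h6 : (2 : ℝ) ^ (2 * j) ≤ 2 ^ (ν + 5) := by
        rw [pow_add, ← h4]
        linarith
      have := (pow_le_pow_iff_right₀ one_lt_two).mp h6
      omega
    · have hd : (d : ℝ) ≤ 2 ^ d := by exact_mod_cast Nat.lt_two_pow_self.le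
      have h6 : (2 : ℝ) ^ ν ≤ 2 ^ (2 * j + d + 1) := by
        calc (2 : ℝ) ^ ν ≤ 2 * (d * 4 ^ j) := by linarith
          _ ≤ 2 * (2 ^ d * 4 ^ j) := by gcongr
          _ = 2 ^ (2 * j + d + 1) := by rw [h4, pow_add, pow_add]; ring
      exact (pow_le_pow_iff_right₀ one_lt_two).mp h6
  have hterm : ∀ ν ∈ Finset.Icc (2 * j - 5) (2 * j + d + 1),
      ENNReal.ofReal (2 ^ ((ν : ℝ) * α)) *
        eLpNorm (conv (compMat (anisoA i ^ j) (S.ψ i) : 𝓢'(Space d, ℂ))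
          (dilate (dyadicI d ^ ν) φ)) p volume ≤
      ENNReal.ofReal (2 ^ (((d : ℝ) + 5) * |α|) * C *
        2 ^ ((2 * α - ((d : ℝ) + 1) * (p⁻¹).toReal) * j)) := by
    intro ν hν
    rw [Finset.mem_Icc] at hν
    -- Since `|ν - 2j| ≤ d + 5`, the weight differs from `2^{2αj}` by a bounded factor, whatever the
    -- sign of `α`.
    have h1 : (2 : ℝ) ^ ((ν : ℝ) * α) ≤ 2 ^ (((d : ℝ) + 5) * |α| + 2 * α * j) := by
      refine Real.rpow_le_rpow_of_exponent_le one_le_two ?_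
      have h2 : |(ν : ℝ) - 2 * j| ≤ d + 5 := by
        have h5 : (2 * j : ℝ) ≤ ν + 5 := by exact_mod_cast (by omega : 2 * j ≤ ν + 5)
        have h6 : (ν : ℝ) ≤ 2 * j + d + 1 := by exact_mod_cast hν.2
        have h7 : (0 : ℝ) ≤ d := d.cast_nonneg
        rw [abs_le]
        constructor <;> linarith
      have h3 : ((ν : ℝ) - 2 * j) * α ≤ (d + 5) * |α| :=
        (le_abs_self _).trans (by rw [abs_mul]; gcongr)
      linarith
    have h2 := hlin _ (norm_matAct_mul_dyadicI_inv_le i (by omega : 2 * j ≤ ν + 5))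
    rw [eLpNorm_conv_compMat_dilate, abs_det_anisoA_pow_rpow]
    calc _ ≤ ENNReal.ofReal (2 ^ (((d : ℝ) + 5) * |α| + 2 * α * j)) *
          (ENNReal.ofReal (2 ^ (((d : ℝ) + 1) * -(p⁻¹).toReal * j)) * ENNReal.ofReal C) := by gcongr
      _ = _ := by
        rw [← ENNReal.ofReal_mul (by positivity), ← ENNReal.ofReal_mul (by positivity)]
        congr 1
        rw [sub_mul, sub_eq_add_neg, Real.rpow_add two_pos, Real.rpow_add two_pos]
        ring_nf
  have hlq := lqNorm_le_of_finset hq (fun ν hν => by rw [hvanish ν hν, eLpNorm_zero, mul_zero]) hterm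
  rw [besovNorm, hlowfreq, eLpNorm_zero, zero_add]
  refine hlq.trans ?_
  have hcard : (((Finset.Icc (2 * j - 5) (2 * j + d + 1)).card : ℕ) : ℝ≥0∞) ≤
      ENNReal.ofReal ((d : ℝ) + 7) := by
    rw [← ENNReal.ofReal_natCast, Nat.card_Icc]
    refine ENNReal.ofReal_le_ofReal ?_
    exact_mod_cast (by omega : 2 * j + d + 1 + 1 - (2 * j - 5) ≤ d + 7)
  calc _ ≤ ENNReal.ofReal ((d : ℝ) + 7) ^ (1 / q.toReal) * _ :=
        mul_le_mul_left (ENNReal.rpow_le_rpow hcard (by positivity)) _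
    _ = _ := by
      rw [ENNReal.ofReal_rpow_of_pos (by positivity), ← ENNReal.ofReal_mul (by positivity)]
      congr 1
      ring

end SingleShearlet

/-! ### Low frequency dilations -/

section LowFrequency

variable {d : ℕ}

/-- The contraction `2^{-j} I`. -/
noncomputable def contraction (d j : ℕ) : GL (Fin d) ℝ :=
  diagGL (fun _ => ((2 : ℝ) ^ j)⁻¹) fun _ => by positivity

theorem matAct_contraction (j : ℕ) (x : Space d) :
    matAct (contraction d j) x = ((2 : ℝ) ^ j)⁻¹ • x := by
  ext k
  rw [matAct_apply, contraction, coe_diagGL]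
  simp [Matrix.mulVec_diagonal]

theorem abs_det_contraction_rpow (j : ℕ) (s : ℝ) :
    |(contraction d j : Matrix (Fin d) (Fin d) ℝ).det| ^ (-s) = 2 ^ (d * s * j) := by
  rw [contraction, coe_diagGL, Matrix.det_diagonal, Finset.prod_const, Finset.card_univ,
    Fintype.card_fin, abs_of_pos (by positivity), ← inv_pow, ← pow_mul, inv_pow,
    Real.inv_rpow (by positivity), Real.rpow_neg (by positivity), inv_inv, ← Real.rpow_natCast,
    ← Real.rpow_mul zero_le_two]
  push_cast
  ring_nf

theorem norm_contraction_le_one (j : ℕ) :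
    ‖(matAct (contraction d j) : Space d →L[ℝ] Space d)‖ ≤ 1 := by
  refine ContinuousLinearMap.opNorm_le_bound _ zero_le_one fun x => ?_
  change ‖matAct (contraction d j) x‖ ≤ _
  rw [matAct_contraction, norm_smul, Real.norm_of_nonneg (by positivity)]
  gcongr
  exact inv_le_one_of_one_le₀ (one_le_pow₀ one_le_two)

theorem eLpNorm_conv_contraction (j : ℕ) (f g : 𝓢(Space d, ℂ)) (p : ℝ≥0∞) :
    eLpNorm (conv (compMat (contraction d j) f : 𝓢'(Space d, ℂ)) g) p volume =
      ENNReal.ofReal (2 ^ (d * (p⁻¹).toReal * j)) *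
        eLpNorm (linConv f g (matAct (contraction d j) : Space d →L[ℝ] Space d)) p volume := by
  have h := eLpNorm_conv_compMat_dilate (contraction d j) 1 f g p
  rwa [dilate_one, inv_one, mul_one, abs_det_contraction_rpow] at h

theorem linConv_zero (f g : 𝓢(Space d, ℂ)) :
    linConv f g 0 = (𝓕 g : 𝓢(Space d, ℂ)) 0 • ⇑f := by
  ext x
  have h : (𝓕 g : 𝓢(Space d, ℂ)) 0 = ∫ z, g z := by
    rw [fourier_coe, Real.fourier_eq]
    simp
  simp [linConv, h, integral_const_mul, mul_comm]

/-- As `T → 0` the functions `linConv f g T` converge pointwise to `ĝ(0) f ≠ 0`. Fatou's lemma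
bounds the lower limit of the norms from below by the norm of this limit. -/
theorem exists_le_eLpNorm_linConv_contraction (f g : 𝓢(Space d, ℂ)) {ξ : Space d}
    (hf : (𝓕 f : 𝓢(Space d, ℂ)) ξ ≠ 0) (hg : (𝓕 g : 𝓢(Space d, ℂ)) 0 ≠ 0) {p : ℝ≥0∞}
    (hp : p ≠ 0) :
    ∃ c : ℝ, 0 < c ∧ ∀ᶠ j : ℕ in atTop, ENNReal.ofReal c ≤
      eLpNorm (linConv f g (matAct (contraction d j) : Space d →L[ℝ] Space d)) p volume := by
  have hne : eLpNorm (linConv f g 0) p volume ≠ 0 := by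
    rw [linConv_zero, eLpNorm_const_smul]
    refine mul_ne_zero (by simpa using hg) fun h => ?_
    rw [eLpNorm_eq_zero_iff f.continuous.aestronglyMeasurable hp] at h
    have h1 : f = 0 :=
      DFunLike.coe_injective ((f.continuous.ae_eq_iff_eq volume continuous_zero).mp h)
    rw [h1, FourierTransform.fourier_zero] at hf
    exact hf rfl
  have hlim : ∀ z : Space d, Tendsto
      (fun j => (matAct (contraction d j) : Space d →L[ℝ] Space d) z) atTop
      (𝓝 ((0 : Space d →L[ℝ] Space d) z)) := by
    intro z
    change Tendsto (fun j => matAct (contraction d j) z) atTop (𝓝 0)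
    simp_rw [matAct_contraction, ← inv_pow]
    have h := (tendsto_pow_atTop_nhds_zero_of_lt_one (by norm_num : (0 : ℝ) ≤ 2⁻¹)
      (by norm_num)).smul_const z
    rwa [zero_smul] at h
  have hfatou := Lp.eLpNorm_lim_le_liminf_eLpNorm (p := p)
    (fun j => (continuous_linConv f g (matAct (contraction d j) : Space d →L[ℝ] Space d)
      ).aestronglyMeasurable (μ := volume)) (linConv f g 0)
    (ae_of_all _ (tendsto_linConv f g norm_contraction_le_one hlim))
  obtain ⟨c, hc0, hc⟩ := ENNReal.lt_iff_exists_nnreal_btwn.mp (pos_iff_ne_zero.mpr hne)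
  refine ⟨c, by exact_mod_cast hc0, ?_⟩
  filter_upwards [eventually_lt_of_lt_liminf (hc.trans_le hfatou)] with j hj
  rw [ENNReal.ofReal_coe_nnreal]
  exact hj.le

theorem fourier_compMat_contraction_ne_zero {f : 𝓢(Space d, ℂ)} {R : ℝ}
    (hf : ∀ ξ, (𝓕 f : 𝓢(Space d, ℂ)) ξ ≠ 0 → ‖ξ‖ ≤ R) (j : ℕ) {ξ : Space d}
    (hξ : (𝓕 (compMat (contraction d j) f) : 𝓢(Space d, ℂ)) ξ ≠ 0) : ‖ξ‖ ≤ (2 ^ j)⁻¹ * R := by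
  obtain ⟨η, rfl⟩ := exists_transpose_mulVec (contraction d j) ξ
  rw [fourier_compMat_transpose_ne_zero] at hξ
  have h1 : WithLp.toLp 2 ((contraction d j : Matrix (Fin d) (Fin d) ℝ)ᵀ *ᵥ WithLp.ofLp η) =
      ((2 : ℝ) ^ j)⁻¹ • η := by
    rw [← matAct_contraction, matAct_apply, contraction, coe_diagGL, Matrix.diagonal_transpose]
  rw [h1, norm_smul, Real.norm_of_nonneg (by positivity)]
  gcongr
  exact hf η hξ

namespace Generators

variable (S : Generators d)

theorem fourier_Ψ_zero_ne_zero : (𝓕 S.Ψ : 𝓢(Space d, ℂ)) 0 ≠ 0 := by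
  have h := S.abs_Ψ 0 (by simp)
  exact norm_ne_zero_iff.mp (by rw [h]; exact one_ne_zero)

theorem norm_le_of_fourier_Ψ_ne_zero {ξ : Space d} (hξ : (𝓕 S.Ψ : 𝓢(Space d, ℂ)) ξ ≠ 0) :
    ‖ξ‖ ≤ d :=
  (norm_le_card_mul (by norm_num) (S.supp_Ψ (subset_tsupport _ hξ))).trans
    (by linarith [(Nat.cast_nonneg d : (0 : ℝ) ≤ d)])

theorem besovABNorm_contraction_lt_top (α : ℝ) (p : ℝ≥0∞) {q : ℝ≥0∞} (hq : 0 < q) (j : ℕ) :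
    besovABNorm S α p q (compMat (contraction d j) S.Ψ : 𝓢'(Space d, ℂ)) < ⊤ :=
  besovABNorm_lt_top S α p hq _ fun _ hξ =>
    fourier_compMat_contraction_ne_zero (fun _ => S.norm_le_of_fourier_Ψ_ne_zero) j hξ

theorem besovABNorm_contraction_ne_zero (α : ℝ) {p : ℝ≥0∞} (hp : 0 < p) (q : ℝ≥0∞) (j : ℕ) :
    besovABNorm S α p q (compMat (contraction d j) S.Ψ : 𝓢'(Space d, ℂ)) ≠ 0 := by
  have h0 := (fourier_compMat_transpose_ne_zero (contraction d j)).mpr S.fourier_Ψ_zero_ne_zero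
  simp only [WithLp.ofLp_zero, Matrix.mulVec_zero, WithLp.toLp_zero] at h0
  exact fun h => eLpNorm_conv_ne_zero _ S.Ψ h0 S.fourier_Ψ_zero_ne_zero hp.ne' (add_eq_zero.mp h).1

theorem exists_le_besovABNorm_contraction (α : ℝ) {p : ℝ≥0∞} (hp : 0 < p) (q : ℝ≥0∞) :
    ∃ c : ℝ, 0 < c ∧ ∀ᶠ j : ℕ in atTop, ENNReal.ofReal (c * 2 ^ (d * (p⁻¹).toReal * j)) ≤
      besovABNorm S α p q (compMat (contraction d j) S.Ψ : 𝓢'(Space d, ℂ)) := by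
  obtain ⟨c, hc, h⟩ := exists_le_eLpNorm_linConv_contraction S.Ψ S.Ψ S.fourier_Ψ_zero_ne_zero
    S.fourier_Ψ_zero_ne_zero hp.ne'
  refine ⟨c, hc, h.mono fun j hj => le_trans ?_ le_self_add⟩
  rw [eLpNorm_conv_contraction, mul_comm c, ENNReal.ofReal_mul (by positivity)]
  gcongr

theorem exists_besovNorm_contraction_le {Φ φ : 𝓢(Space d, ℂ)} (hφ : IsDyadicPair Φ φ) (α : ℝ)
    (p : ℝ≥0∞) {q : ℝ≥0∞} (hq : 0 < q) :
    ∃ C : ℝ, ∀ᶠ j : ℕ in atTop,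
      besovNorm Φ φ α p q (compMat (contraction d j) S.Ψ : 𝓢'(Space d, ℂ)) ≤
        ENNReal.ofReal (C * 2 ^ (d * (p⁻¹).toReal * j)) := by
  obtain ⟨C, hC, hlin⟩ := exists_eLpNorm_linConv_le S.Ψ Φ 1 p
  refine ⟨C, ?_⟩
  -- The spectrum lies in `‖ξ‖ ≤ d 2^{-j}`, which is less than `1/2` for `j ≥ d + 1`, whereas every
  -- block `φ_{2^ν I}` requires `‖ξ‖ ≥ 1/2`.
  filter_upwards [eventually_ge_atTop (d + 1)] with j hj
  have hvanish : ∀ ν : ℕ, conv (compMat (contraction d j) S.Ψ : 𝓢'(Space d, ℂ))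
      (dilate (dyadicI d ^ ν) φ) = 0 := by
    intro ν
    refine conv_eq_zero_of_fourier _ _ fun ξ hξ => ?_
    by_contra hne
    have h1 := fourier_compMat_contraction_ne_zero (fun _ => S.norm_le_of_fourier_Ψ_ne_zero) j hξ
    have h2 := (hφ.norm_of_fourier_dilate_ne_zero ν hne).1
    have h3 : (1 : ℝ) ≤ 2 ^ ν := one_le_pow₀ one_le_two
    have h4 : (d : ℝ) < 2 ^ d := by exact_mod_cast Nat.lt_two_pow_self
    have h5 : (2 : ℝ) ^ (d + 1) ≤ 2 ^ j := pow_le_pow_right₀ one_le_two hj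
    rw [pow_succ] at h5
    rw [inv_mul_eq_div, le_div_iff₀ (by positivity)] at h1
    have h6 : (0 : ℝ) < 2 ^ j := by positivity
    nlinarith
  have hlq := lqNorm_le_of_finset hq (a := fun ν : ℕ => ENNReal.ofReal (2 ^ ((ν : ℝ) * α)) *
    eLpNorm (conv (compMat (contraction d j) S.Ψ : 𝓢'(Space d, ℂ)) (dilate (dyadicI d ^ ν) φ)) p
      volume) (s := ∅) (M := 0) (fun ν _ => by rw [hvanish ν, eLpNorm_zero, mul_zero]) (by simp)
  rw [mul_zero, nonpos_iff_eq_zero] at hlq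
  rw [besovNorm, hlq, add_zero, eLpNorm_conv_contraction, mul_comm C,
    ENNReal.ofReal_mul (by positivity)]
  gcongr
  exact hlin _ (norm_contraction_le_one j)

end Generators

end LowFrequency

end Shearlet

/-! ### The two regimes of the exponents -/

theorem mainTheorem9 (d : ℕ) (hd : 2 ≤ d)
    (S : Shearlet.Generators d)
    (Φ φ : 𝓢(Shearlet.Space d, ℂ)) (hφ : Shearlet.IsDyadicPair Φ φ)
    (α₁ α₂ : ℝ) (p₁ p₂ q₁ q₂ : ℝ≥0∞)
    (hp₁ : 0 < p₁) (hp₂ : 0 < p₂) (hq₁ : 0 < q₁) (hq₂ : 0 < q₂)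
    (h : 2 * α₁ + 3 / 2 * d <
      (d + 1) * (α₂ - d * (p₂⁻¹).toReal / (d + 1) + 1 / 2) + 1 / 2 + d * (p₁⁻¹).toReal)
    (i : Fin d) :
    ∃ f : ℕ → 𝓢(Shearlet.Space d, ℂ),
      (∀ j, (f j : 𝓢'(Shearlet.Space d, ℂ)) ∈ Shearlet.besovAB S α₂ p₂ q₂) ∧
      (∃ c C : ℝ, 0 < c ∧ ∀ j,
        ENNReal.ofReal c ≤ Shearlet.besovABNorm S α₂ p₂ q₂ (f j : 𝓢'(Shearlet.Space d, ℂ)) ∧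
        Shearlet.besovABNorm S α₂ p₂ q₂ (f j : 𝓢'(Shearlet.Space d, ℂ)) ≤ ENNReal.ofReal C) ∧
      Tendsto (fun j => Shearlet.besovNorm Φ φ α₁ p₁ q₁ (f j : 𝓢'(Shearlet.Space d, ℂ))) atTop (𝓝 0) ∧
      ((p₂⁻¹).toReal ≤ (p₁⁻¹).toReal + (d - 1) →
        ∀ j, ∃ a : ℂ, f j = a • S.shearlet i j 0 0) := by
  have hd' : (2 : ℝ) ≤ d := by exact_mod_cast hd
  suffices hmain : ∃ f : ℕ → 𝓢(Shearlet.Space d, ℂ),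
      (∀ j, Shearlet.besovABNorm S α₂ p₂ q₂ (f j : 𝓢'(Shearlet.Space d, ℂ)) = 1) ∧
      Tendsto (fun j => Shearlet.besovNorm Φ φ α₁ p₁ q₁ (f j : 𝓢'(Shearlet.Space d, ℂ)))
        atTop (𝓝 0) ∧
      ((p₂⁻¹).toReal ≤ (p₁⁻¹).toReal + (d - 1) →
        ∀ j, ∃ a : ℂ, f j = a • S.shearlet i j 0 0) by
    obtain ⟨f, h1, h2, h3⟩ := hmain
    refine ⟨f, fun j => ?_, ⟨1, 1, one_pos, fun j => ?_⟩, h2, h3⟩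
    · change Shearlet.besovABNorm S α₂ p₂ q₂ _ < ⊤
      rw [h1]
      exact ENNReal.one_lt_top
    · rw [h1, ENNReal.ofReal_one]
      exact ⟨le_rfl, le_rfl⟩
  by_cases hp : (p₂⁻¹).toReal ≤ (p₁⁻¹).toReal + (d - 1)
  -- The right side minus the left side exceeds `1/p₁ + d - 1 - 1/p₂` by the gap in `h`, and `hp`
  -- makes that quantity nonnegative.
  · have hexp : 2 * α₁ - ((d : ℝ) + 1) * (p₁⁻¹).toReal <
        ((d : ℝ) + 1) * (α₂ - (p₂⁻¹).toReal) := by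
      have h1 : ((d : ℝ) + 1) * (α₂ - d * (p₂⁻¹).toReal / (d + 1) + 1 / 2) =
          (d + 1) * α₂ - d * (p₂⁻¹).toReal + (d + 1) / 2 := by
        field_simp
      rw [h1] at h
      linarith
    obtain ⟨c, hc, hlow⟩ := S.exists_le_besovABNorm_compMat i α₂ hp₂ hq₂
    obtain ⟨C, hup⟩ := S.exists_besovNorm_compMat_le hφ i α₁ p₁ hq₁
    obtain ⟨a, ha, hlim⟩ := Shearlet.exists_normalization S Φ φ hq₁ hq₂
      (fun j => Shearlet.compMat (Shearlet.anisoA i ^ j) (S.ψ i))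
      (fun j => ((ENNReal.ofReal_pos.mpr (by positivity)).trans_le (hlow j)).ne')
      (fun j => Shearlet.besovABNorm_lt_top S α₂ p₂ hq₂ _ fun ξ hξ =>
        (S.norm_of_fourier_compMat_anisoA_ne_zero i j hξ).2)
      hc hexp (Eventually.of_forall hlow) hup
    refine ⟨_, ha, hlim, fun _ j => ?_⟩
    -- The inverse factor undoes the `L²` normalisation of the shearlet.
    refine ⟨a j * ((((2 : ℝ) ^ (((d : ℝ) + 1) * (1 / 2) * j) : ℝ) : ℂ))⁻¹, ?_⟩
    have hne : (((2 : ℝ) ^ (((d : ℝ) + 1) * (1 / 2) * j) : ℝ) : ℂ) ≠ 0 := by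
      exact_mod_cast (by positivity : (0 : ℝ) < 2 ^ (((d : ℝ) + 1) * (1 / 2) * j)).ne'
    rw [S.shearlet_zero_zero, smul_smul, mul_assoc, inv_mul_cancel₀ hne, mul_one]
  -- Here `1/p₂ > 1/p₁ + d - 1 > 1/p₁`, because `d ≥ 2`.
  · have hexp : d * (p₁⁻¹).toReal < d * (p₂⁻¹).toReal :=
      mul_lt_mul_of_pos_left (by linarith) (by linarith)
    obtain ⟨c, hc, hlow⟩ := S.exists_le_besovABNorm_contraction α₂ hp₂ q₂
    obtain ⟨C, hup⟩ := S.exists_besovNorm_contraction_le hφ α₁ p₁ hq₁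
    obtain ⟨a, ha, hlim⟩ := Shearlet.exists_normalization S Φ φ hq₁ hq₂
      (fun j => Shearlet.compMat (Shearlet.contraction d j) S.Ψ)
      (S.besovABNorm_contraction_ne_zero α₂ hp₂ q₂) (S.besovABNorm_contraction_lt_top α₂ p₂ hq₂)
      hc hexp hlow hup
    exact ⟨_, ha, hlim, fun h' => absurd h' hp⟩
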